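/- Conventions. Languages and theories are first order and one-sorted, possibly uncountable; a theory is consistent, complete and deductively closed, so the cardinality of an $L$-theory is $|L|+\aleph_0$. "Definable" means first-order definable with parameters. $k\ge 1$ is an integer and $\kappa$ is an infinite cardinal. Definitions. Let $N,M$ be structures. * $N$ trace defines $M$ if for some $n$ there is an injection $\tau:M\to N^n$ such that for every $m$ every $M$-definable $X\subseteq M^m$ is of the form $\{a\in M^m:(\tau(a_1),\dots,\tau(a_m))\in Y\}$ for some $N$-definable $Y\subseteq N^{nm}$. $N$ locally trace defines $M$ if for every $M$-definable $X\subseteq M^m$ there are $n$, an injection $\tau:M\to N^n$ and an $N$-definable $Y\subseteq N^{nm}$ with $X=\{a\in M^m:(\tau(a_1),\dots,\tau(a_m))\in Y\}$. * A collection $\mathcal E$ of functions $M^k\to N$ witnesses local $k$-trace definability of $M$ in $N$ if every $M$-definable subset of every $M^n$ is quantifier-free definable, with parameters from both sorts, in the two-sorted structure $(M,N,\mathcal E)$, where the sort $M$ carries only equality and $N$ has been expanded by predicates for its definable sets. In other words, every $M$-definable subset of $M^n$ is a Boolean combination of sets $\{a\in M^n:s(a)=t(a)\}$ and $\{a\in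 M^n:(f_1(t_{1,1}(a),\dots,t_{1,k}(a)),\dots,f_d(t_{d,1}(a),\dots,t_{d,k}(a)))\in Y\}$, where $f_1,\dots,f_d\in\mathcal E$, $Y\subseteq N^d$ is $N$-definable, and each of $s,t,t_{j,l}:M^n\to M$ is a coordinate function or a constant function. $N$ locally $k$-trace defines $M$ if such an $\mathcal E$ exists, and $N$ $k$-trace defines $M$ if there is a finite such $\mathcal E$. * A theory $T$ trace defines (locally trace defines, $k$-trace defines, locally $k$-trace defines, locally $k$-trace defines as witnessed by at most $\kappa$ functions) a theory $T^*$ if some model of $T^*$ is so definable in some model of $T$. Two theories are (locally) trace equivalent if each (locally) trace defines the other. * Let $I$ be a non-empty index set. A family $(f_i)_{i\in I}$ of functions $P^k\to M$ is rich if for every finite $J\subseteq I$, all finite sets $X,Y$ with functions $\sigma_i:X^k\to Y$ $(i\in J)$, every $A\subseteq X$, and all injections $p:A\to P$, $q:Y\to M$ with $f_i(p(a_1),\dots,p(a_k))=q(\sigma_i(a_1,\dots,a_k))$ for all $i\in J$ and $a\in A^k$, there is an injection $p':X\to P$ extending $p$ with $f_i(p'(a_1),\dots,p'(a_k))=q(\sigma_i(a_1,\dots,a_k))$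 for all $i\in J$ and $a\in X^k$. For a theory $T$, $D^\kappa_k(T)$ is the theory of the two-sorted structures $(P,M,(f_i)_{i<\kappa})$ where $M\models T$, $P$ is an infinite set and $(f_i)_{i<\kappa}$ is a rich family of functions $P^k\to M$; $D_k(T)$ is defined in the same way with a single function. These structures are regarded as one-sorted structures on the disjoint union $P\sqcup M$, with unary predicates for $P$ and $M$, the relations of $M$, and the graphs of the functions of $M$ and of the $f_i$. Theorem. Suppose that either $T$ has infinite models, or $T$ has a finite model with at least two elements and $k\ge 2$. Let $\kappa\ge\aleph_0$. Then $D_k(T)$ and $D^\kappa_k(T)$ are theories (consistent, complete and deductively closed), and for every theory $T^*$: (1) $T$ $k$-trace defines $T^*$ if and only if $D_k(T)$ trace defines $T^*$. (2) $T$ locally $k$-trace defines $T^*$ if and only if $D_k(T)$ locally trace defines $T^*$. (3) $T$ locally $k$-trace defines $T^*$, witnessed by at most $\kappa$ functions, if and only if $D^\kappa_k(T)$ trace defines $T^*$. (4) If $\kappa\ge|T^*|$, then $T$ locally $k$-trace defines $T^*$ if and only if $D^\kappa_k(T)$ trace defines $T^*$. Furthermore: (a) $D_k(T)$ is the unique theory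 modulo trace equivalence satisfying (1) for all $T^*$: a theory $S$ satisfies [for all $T^*$: $T$ $k$-trace defines $T^*$ iff $S$ trace defines $T^*$] if and only if $S$ is trace equivalent to $D_k(T)$. (b) $D_k(T)$ is, in the same sense, the unique theory modulo local trace equivalence satisfying (2) for all $T^*$. (c) $D^\kappa_k(T)$ is, in the same sense, the unique theory modulo trace equivalence satisfying (3) for all $T^*$. (d) If $\kappa\ge|T|$, then $|D^\kappa_k(T)|\le\kappa$ and $D^\kappa_k(T)$ is, in the same sense, the unique theory of cardinality $\le\kappa$ modulo trace equivalence satisfying (4) for all $T^*$ of cardinality $\le\kappa$. -/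

import Mathlib

universe u

namespace TraceDef

/-! ### Quantifier-free definability over a structure through functions

`M` is a set, `N` an `L`-structure, `E` a collection of functions `M^k → N`. We consider the
two-sorted structure `(M, N, E)`, where the sort `M` carries only equality and `N` has been
expanded by predicates for its definable sets, so that it eliminates quantifiers.
A term of sort `M` in the variables `x_0, …, x_{n-1}` (all of sort `M`) is either a variable or a
parameter from `M`, so terms of sort `M` are elements of `Fin n ⊕ M`; a term of sort `N` is a
function from `E` applied to `k` terms of sort `M`, or a parameter from `N` (parameters from `N` are
absorbed in the definable set `Y` below). -/

/-- The value of a term of sort `M` at the point `a ∈ M^n`. -/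
def termVal {M : Type u} {n : ℕ} (a : Fin n → M) : Fin n ⊕ M → M :=
  Sum.elim a id

/-- `QFDefinable L E X`: the set `X ⊆ M^n` is quantifier-free definable, with parameters from both
sorts, in the two-sorted structure `(M, N, E)`, i.e. it is a Boolean combination of sets defined by
atomic formulas: equalities between terms of sort `M`, and `N`-definable relations between terms of
sort `N`. -/
inductive QFDefinable (L : FirstOrder.Language.{u, u}) {M N : Type u} [L.Structure N] {k : ℕ}
    (E : Set ((Fin k → M) → N)) {n : ℕ} : Set (Fin n → M) → Prop
  | eq (s t : Fin n ⊕ M) : QFDefinable L E {a | termVal a s = termVal a t}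
  | rel (d : ℕ) (f : Fin d → (Fin k → M) → N) (hf : ∀ j, f j ∈ E)
      (t : Fin d → Fin k → Fin n ⊕ M) (Y : Set (Fin d → N))
      (hY : (Set.univ : Set N).Definable L Y) :
      QFDefinable L E {a | (fun j => f j (fun l => termVal a (t j l))) ∈ Y}
  | compl (X : Set (Fin n → M)) : QFDefinable L E X → QFDefinable L E Xᶜ
  | inter (X X' : Set (Fin n → M)) :
      QFDefinable L E X → QFDefinable L E X' → QFDefinable L E (X ∩ X')

section Structures

variable (L : FirstOrder.Language.{u, u}) (N : Type u) [L.Structure N]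
  (L' : FirstOrder.Language.{u, u}) (M : Type u) [L'.Structure M]

/-- The collection `E` of functions `M^k → N` witnesses local `k`-trace definability of the
structure `M` in the structure `N`: every `M`-definable set (with parameters) is quantifier-free
definable in `(M, N, E)`. -/
def Witnesses (k : ℕ) (E : Set ((Fin k → M) → N)) : Prop :=
  ∀ (n : ℕ) (X : Set (Fin n → M)), (Set.univ : Set M).Definable L' X → QFDefinable L E X

/-- The structure `N` trace defines the structure `M`. -/
def StrTraceDefines : Prop :=
  ∃ (n : ℕ) (τ : M → Fin n → N), Function.Injective τ ∧
    ∀ (m : ℕ) (X : Set (Fin m → M)), (Set.univ : Set M).Definable L' X →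
      ∃ Y : Set (Fin m × Fin n → N), (Set.univ : Set N).Definable L Y ∧
        X = {a | (fun p : Fin m × Fin n => τ (a p.1) p.2) ∈ Y}

/-- The structure `N` locally trace defines the structure `M`. -/
def StrLocallyTraceDefines : Prop :=
  ∀ (m : ℕ) (X : Set (Fin m → M)), (Set.univ : Set M).Definable L' X →
    ∃ (n : ℕ) (τ : M → Fin n → N), Function.Injective τ ∧
      ∃ Y : Set (Fin m × Fin n → N), (Set.univ : Set N).Definable L Y ∧
        X = {a | (fun p : Fin m × Fin n => τ (a p.1) p.2) ∈ Y}

end Structures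

section Theories

variable {L : FirstOrder.Language.{u, u}} (T : L.Theory) {L' : FirstOrder.Language.{u, u}} (T' : L'.Theory)

/-- `T` trace defines `T'`: some model of `T'` is trace definable in a model of `T`. -/
def TraceDefines : Prop :=
  ∃ (M : FirstOrder.Language.Theory.ModelType.{u, u, u} T') (N : FirstOrder.Language.Theory.ModelType.{u, u, u} T),
    StrTraceDefines L N L' M

/-- `T` locally trace defines `T'`. -/
def LocallyTraceDefines : Prop :=
  ∃ (M : FirstOrder.Language.Theory.ModelType.{u, u, u} T') (N : FirstOrder.Language.Theory.ModelType.{u, u, u} T),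
    StrLocallyTraceDefines L N L' M

/-- `T` `k`-trace defines `T'`: this is witnessed by a finite collection of functions. -/
def KTraceDefines (k : ℕ) : Prop :=
  ∃ (M : FirstOrder.Language.Theory.ModelType.{u, u, u} T') (N : FirstOrder.Language.Theory.ModelType.{u, u, u} T)
    (E : Set ((Fin k → M) → N)), E.Finite ∧ Witnesses L N L' M k E

/-- `T` locally `k`-trace defines `T'`. -/
def LocallyKTraceDefines (k : ℕ) : Prop :=
  ∃ (M : FirstOrder.Language.Theory.ModelType.{u, u, u} T') (N : FirstOrder.Language.Theory.ModelType.{u, u, u} T)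
    (E : Set ((Fin k → M) → N)), Witnesses L N L' M k E

/-- `T` locally `k`-trace defines `T'`, and this is witnessed by at most `κ` functions. -/
def LocallyKTraceDefinesWith (κ : Cardinal.{u}) (k : ℕ) : Prop :=
  ∃ (M : FirstOrder.Language.Theory.ModelType.{u, u, u} T') (N : FirstOrder.Language.Theory.ModelType.{u, u, u} T)
    (E : Set ((Fin k → M) → N)), Cardinal.mk E ≤ κ ∧ Witnesses L N L' M k E

/-- Trace equivalence of theories. -/
def TraceEquivalent : Prop :=
  TraceDefines T T' ∧ TraceDefines T' T

/-- Local trace equivalence of theories. -/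
def LocallyTraceEquivalent : Prop :=
  LocallyTraceDefines T T' ∧ LocallyTraceDefines T' T

end Theories

/-! ### Generic functions -/

/-- A family `f` of functions `P^k → M` is rich: for every finite subfamily `J`, every finite
`(J, k)`-function structure `(X, Y; σ)` and every `A ⊆ X`, each embedding `(p, q)` of
`(A, Y; σ)` into `(P, M; f)` extends to an embedding `(p', q)` of `(X, Y; σ)`. -/
def Rich {I P M : Type u} {k : ℕ} (f : I → (Fin k → P) → M) : Prop :=
  ∀ (J : Finset I) (X Y : Type) [Finite X] [Finite Y] (σ : J → (Fin k → X) → Y)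
    (A : Set X) (p : A ↪ P) (q : Y ↪ M),
    (∀ (i : J) (a : Fin k → A), f i (fun l => p (a l)) = q (σ i (fun l => (a l : X)))) →
    ∃ p' : X ↪ P, (∀ a : A, p' a = p a) ∧
      ∀ (i : J) (a : Fin k → X), f i (fun l => p' (a l)) = q (σ i a)

/-- The relation symbols of the one-sorted language of the structures `(P, M, (f_i)_{i ∈ I})` with
`M` an `L`-structure and `f_i : P^k → M`: unary relations for the two sorts, and, since a function
defined on one of the sorts is only partially defined on `P ∪ M`, a relation for the graph of every
function symbol of `L` and for the graph of every `f_i`. -/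
inductive GenRel (L : FirstOrder.Language.{u, u}) (I : Type u) (k : ℕ) : ℕ → Type u
  | inP : GenRel L I k 1
  | inM : GenRel L I k 1
  | graph {n : ℕ} (g : L.Functions n) : GenRel L I k (n + 1)
  | rel {n : ℕ} (R : L.Relations n) : GenRel L I k n
  | fn (i : I) : GenRel L I k (k + 1)

/-- The one-sorted relational language of the structures `(P, M, (f_i)_{i ∈ I})`. -/
def genLang (L : FirstOrder.Language.{u, u}) (I : Type u) (k : ℕ) : FirstOrder.Language.{u, u} :=
  ⟨fun _ => PEmpty, GenRel L I k⟩

/-- The structure `(P, M, (f_i)_{i ∈ I})` as a one-sorted structure on the disjoint union `P ⊕ M`. -/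
@[reducible] def genStructure (L : FirstOrder.Language.{u, u}) {I P M : Type u} [L.Structure M] {k : ℕ}
    (f : I → (Fin k → P) → M) : (genLang L I k).Structure (P ⊕ M) where
  funMap := fun g => PEmpty.elim g
  RelMap := fun r v =>
    match r, v with
    | .inP, v => ∃ p : P, v 0 = Sum.inl p
    | .inM, v => ∃ b : M, v 0 = Sum.inr b
    | .graph (n := n) g, v => ∃ x : Fin n → M,
        (∀ j : Fin n, v j.castSucc = Sum.inr (x j)) ∧
          v (Fin.last n) = Sum.inr (FirstOrder.Language.Structure.funMap g x)
    | .rel (n := n) R, v => ∃ x : Fin n → M,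
        (∀ j : Fin n, v j = Sum.inr (x j)) ∧ FirstOrder.Language.Structure.RelMap R x
    | .fn i, v => ∃ x : Fin k → P,
        (∀ j : Fin k, v j.castSucc = Sum.inl (x j)) ∧ v (Fin.last k) = Sum.inr (f i x)

section Generic

variable {L : FirstOrder.Language.{u, u}} (T : L.Theory)

/-- The theory of the structures `(P, M, (f_i)_{i ∈ I})` where `M` is a model of `T`, `P` is an
infinite set and `(f_i)` is a rich family of functions `P^k → M`. -/
def genTheory (I : Type u) (k : ℕ) : (genLang L I k).Theory :=
  {φ | ∀ (M : FirstOrder.Language.Theory.ModelType.{u, u, u} T) (P : Type u) (f : I → (Fin k → P) → M),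
    Infinite P → Rich f →
      @FirstOrder.Language.Sentence.Realize (genLang L I k) (P ⊕ M) (genStructure L f) φ}

/-- `D^κ_k(T)`. -/
abbrev Dκ (κ : Cardinal.{u}) (k : ℕ) : (genLang L κ.out k).Theory :=
  genTheory T κ.out k

/-- `D_k(T)`, the theory with a single generic function. -/
abbrev D (k : ℕ) : (genLang L PUnit.{u + 1} k).Theory :=
  genTheory T PUnit.{u + 1} k

end Generic

end TraceDef

namespace TraceDef

open FirstOrder FirstOrder.Language

/-! ### Definable sets as instances of formulas in finitely many variables -/

section Definable

variable {L : FirstOrder.Language.{u, u}}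

/-! The core is a quantifier elimination for rich structures `(P, M, f)`. Relative to finitely many
points of `P`, a new point matters only through finitely many values of the `f_i` at tuples passing
through it, and richness realises every prescription of these values. A quantifier over new points
is therefore a block of quantifiers over `M`. Once the sorts of the variables and the equalities
among them are fixed, every formula becomes an `L`-formula in the variables of sort `M` and the
values of the `f_i` (`eliminable_realize`). For a sentence only an `L`-sentence remains, which `T`
decides; this gives completeness (`genTheory_isMaximal`). Richness is a first-order scheme, so every
model is again a rich structure (`exists_equiv_genModel`).

From functions to traces: any family of functions `O^k → M` extends to a rich family on some `P ⊇ O`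
(`exists_rich_extension`), which handles `κ` functions with one copy of `O`. A single function codes
a whole family on the set of pairs (point, index): it reads the index from its first argument, and
each index gives one coordinate map `o ↦ (o, index)` (`exists_rich_code`). A finite family yields
finitely many coordinates; in the local case each definable set uses only finitely many functions.

From traces to functions: given `τ : O → (P ⊕ M)^r`, pull the `f_i` back along the coordinates of
`τ`. By elimination the preimages of definable sets are quantifier-free definable, as soon as
equality between coordinates is (`qfDefinable_pull`). Here the hypothesis on `T` enters
(`exists_equality_coding`): either `M` is infinite and has an elementary extension into which `P ⊕
M` injects, or `k ≥ 2` and the indicator of equality is a function of two arguments with two values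
in `M`. Parameters from `P` are not available as terms; they are stored as values of an additional
coordinate on a sufficiently large model of `T*` (`exists_witnesses_of_strTraceDefines`).

Part (4) reduces to (3), since at most `κ` formulas each need finitely many functions. Uniqueness is
formal: trace definability is reflexive and transitive on complete theories, so one tests at the
generic theory and at `S`. Transitivity requires moving from one model of a complete theory to
another, which costs an ultrapower of the defining structure. -/

theorem exists_formula_fin {α : Type*} (φ : L.Formula α) :
    ∃ (m : ℕ) (ψ : L.Formula (Fin m)) (t : Fin m → α),
      ∀ (M : Type u) [L.Structure M] (v : α → M), φ.Realize v ↔ ψ.Realize (v ∘ t) := by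
  classical
  let e := φ.freeVarFinset.equivFin
  refine ⟨_, (BoundedFormula.restrictFreeVar φ e : L.Formula _),
    fun i => (e.symm i : α), fun M _ v => ?_⟩
  exact (BoundedFormula.realize_restrictFreeVar (φ := φ) (f := e) (v := v ∘ fun i => (e.symm i : α))
    v (by simp)).symm

theorem definable_realize {M : Type u} [L.Structure M] {α β : Type*} (φ : L.Formula β)
    (t : β → α ⊕ M) : (Set.univ : Set M).Definable L {a : α → M | φ.Realize (Sum.elim a id ∘ t)} := by
  rw [Set.definable_iff_exists_formula_sum]
  refine ⟨φ.relabel (Sum.elim Sum.inr (fun b => Sum.inl ⟨b, trivial⟩) ∘ t), ?_⟩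
  ext a
  simp only [Set.mem_ofPred_eq, Formula.realize_relabel]
  have : Sum.elim a id ∘ t = (Sum.elim (fun b : (Set.univ : Set M) => (b : M)) a) ∘
      (Sum.elim Sum.inr (fun b => Sum.inl ⟨b, trivial⟩) ∘ t) := by
    funext i
    simp only [Function.comp]
    rcases t i with x | b <;> rfl
  rw [this]

/-- This normal form separates a parameter-free formula from the substitution of variables and
parameters, so that statements about all definable sets reduce to formulas in finitely many
variables. -/
theorem exists_eq_realize {M : Type u} [L.Structure M] {α : Type*} {X : Set (α → M)}
    (hX : (Set.univ : Set M).Definable L X) :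
    ∃ (m : ℕ) (φ : L.Formula (Fin m)) (t : Fin m → α ⊕ M),
      X = {a | φ.Realize (Sum.elim a id ∘ t)} := by
  obtain ⟨φ, rfl⟩ := Set.definable_iff_exists_formula_sum.1 hX
  obtain ⟨m, ψ, t, h⟩ := exists_formula_fin φ
  refine ⟨m, ψ, fun i => Sum.elim (fun b => Sum.inr b.1) Sum.inl (t i), ?_⟩
  ext a
  simp only [Set.mem_ofPred_eq, h]
  have : Sum.elim a id ∘ (fun i => Sum.elim (fun b : (Set.univ : Set M) => Sum.inr b.1) Sum.inl (t i))
      = Sum.elim (fun b : (Set.univ : Set M) => (b : M)) a ∘ t := by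
    funext i
    simp only [Function.comp]
    rcases t i with x | b <;> rfl
  rw [this]

theorem definable_preimage_subst {M : Type u} [L.Structure M] {α β : Type*} {Y : Set (β → M)}
    (hY : (Set.univ : Set M).Definable L Y) (s : β → α ⊕ M) :
    (Set.univ : Set M).Definable L {a : α → M | Sum.elim a id ∘ s ∈ Y} := by
  obtain ⟨m, φ, t, rfl⟩ := exists_eq_realize hY
  convert! definable_realize φ (fun i => Sum.elim s Sum.inr (t i)) using 1
  ext a
  simp only [Set.mem_ofPred_eq]
  have : Sum.elim (Sum.elim a id ∘ s) id ∘ t = Sum.elim a id ∘ fun i => Sum.elim s Sum.inr (t i) := by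
    funext i
    simp only [Function.comp]
    rcases t i with x | b <;> rfl
  rw [this]

end Definable

/-! ### Traces -/

section Trace

variable (L : FirstOrder.Language.{u, u}) {N : Type u} [L.Structure N] {M : Type u}

/-- `X` is the preimage under `τ` of a definable set. -/
def IsTrace {s α : Type*} (τ : M → s → N) (X : Set (α → M)) : Prop :=
  ∃ Y : Set (α × s → N), (Set.univ : Set N).Definable L Y ∧ X = {a | (fun p : α × s => τ (a p.1) p.2) ∈ Y}

variable {L}

/-- A parameter `b` from `M` turns into the parameters `τ b i` from `N`. -/
theorem IsTrace.subst {s α β : Type*} {τ : M → s → N} {X : Set (β → M)} (h : IsTrace L τ X)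
    (t : β → α ⊕ M) : IsTrace L τ {a : α → M | Sum.elim a id ∘ t ∈ X} := by
  obtain ⟨Y, hY, rfl⟩ := h
  refine ⟨_, definable_preimage_subst hY
    (fun p : β × s => Sum.elim (fun x => Sum.inl (x, p.2)) (fun b => Sum.inr (τ b p.2)) (t p.1)), ?_⟩
  ext a
  simp only [Set.mem_ofPred_eq]
  apply iff_of_eq
  congr 1
  funext p
  simp only [Function.comp]
  rcases t p.1 with x | b <;> rfl

theorem IsTrace.reindex {s s' α : Type*} {τ : M → s → N} {X : Set (α → M)} (h : IsTrace L τ X)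
    {τ' : M → s' → N} (e : s → s') (he : ∀ b i, τ b i = τ' b (e i)) :
    IsTrace L τ' X := by
  obtain ⟨Y, hY, rfl⟩ := h
  refine ⟨_, definable_preimage_subst hY (fun p : α × s => Sum.inl (p.1, e p.2)), ?_⟩
  ext a
  simp only [Set.mem_ofPred_eq]
  apply iff_of_eq
  congr 1
  funext p
  simp [he]

theorem IsTrace.compl {s α : Type*} {τ : M → s → N} {X : Set (α → M)} (h : IsTrace L τ X) :
    IsTrace L τ Xᶜ := by
  obtain ⟨Y, hY, rfl⟩ := h
  exact ⟨Yᶜ, hY.compl, rfl⟩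

theorem IsTrace.inter {s α : Type*} {τ : M → s → N} {X X' : Set (α → M)} (h : IsTrace L τ X)
    (h' : IsTrace L τ X') : IsTrace L τ (X ∩ X') := by
  obtain ⟨Y, hY, rfl⟩ := h
  obtain ⟨Y', hY', rfl⟩ := h'
  exact ⟨Y ∩ Y', hY.inter hY', rfl⟩

theorem IsTrace.comp {O : Type u} {L' : FirstOrder.Language.{u, u}} [L'.Structure M] {s s' α : Type*} {σ : O → s' → M}
    {X : Set (α → O)} {τ : M → s → N} (h : IsTrace L' σ X)
    (h' : ∀ (m : ℕ) (Y : Set (Fin m → M)), (Set.univ : Set M).Definable L' Y → IsTrace L τ Y) :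
    IsTrace L (fun o (p : s' × s) => τ (σ o p.1) p.2) X := by
  obtain ⟨Y, hY, rfl⟩ := h
  obtain ⟨m, φ, t, rfl⟩ := exists_eq_realize hY
  obtain ⟨Z, hZ, e⟩ := (h' m {a | φ.Realize a} (by
    simpa using definable_realize φ (Sum.inl (β := M)))).subst (α := α × s') t
  refine ⟨_, definable_preimage_subst hZ
    (fun p : (α × s') × s => Sum.inl (p.1.1, p.1.2, p.2)), ?_⟩
  ext a
  simp only [Set.mem_ofPred_eq]
  have := Set.ext_iff.1 e (fun p : α × s' => σ (a p.1) p.2)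
  simp only [Set.mem_ofPred_eq] at this
  exact this

theorem isTrace_of_formula {L' : FirstOrder.Language.{u, u}} [L'.Structure M] {s α : Type*} {τ : M → s → N}
    (h : ∀ (m : ℕ) (φ : L'.Formula (Fin m)), IsTrace L τ {a | φ.Realize a})
    {X : Set (α → M)} (hX : (Set.univ : Set M).Definable L' X) : IsTrace L τ X := by
  obtain ⟨m, φ, t, rfl⟩ := exists_eq_realize hX
  exact (h m φ).subst t

theorem definable_formula {L' : FirstOrder.Language.{u, u}} [L'.Structure M] {α : Type*} (φ : L'.Formula α) :
    (Set.univ : Set M).Definable L' {a | φ.Realize a} := by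
  simpa using definable_realize φ (Sum.inl (β := M))

variable (L N) in
theorem strTraceDefines_of_finite (L' : FirstOrder.Language.{u, u}) [L'.Structure M] {s : Type*} [Finite s]
    (τ : M → s → N) (hτ : Function.Injective τ)
    (h : ∀ (m : ℕ) (X : Set (Fin m → M)), (Set.univ : Set M).Definable L' X → IsTrace L τ X) :
    StrTraceDefines L N L' M := by
  obtain ⟨n, ⟨e⟩⟩ := Finite.exists_equiv_fin s
  refine ⟨n, fun b i => τ b (e.symm i), fun b c hbc => hτ ?_, fun m X hX => ?_⟩
  · funext i
    simpa using congrFun hbc (e i)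
  · exact IsTrace.reindex (h m X hX) (τ' := fun b i => τ b (e.symm i)) e (fun b i => by simp)

variable (L N) in
theorem strLocallyTraceDefines_of_finite (L' : FirstOrder.Language.{u, u}) [L'.Structure M]
    (h : ∀ (m : ℕ) (X : Set (Fin m → M)), (Set.univ : Set M).Definable L' X →
      ∃ (s : Type u) (_ : Finite s) (τ : M → s → N), Function.Injective τ ∧ IsTrace L τ X) :
    StrLocallyTraceDefines L N L' M := by
  intro m X hX
  obtain ⟨s, _, τ, hτ, hs⟩ := h m X hX
  obtain ⟨n, ⟨e⟩⟩ := Finite.exists_equiv_fin s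
  refine ⟨n, fun b i => τ b (e.symm i), fun b c hbc => hτ ?_,
    IsTrace.reindex hs (τ' := fun b i => τ b (e.symm i)) e (fun b i => by simp)⟩
  funext i
  simpa using congrFun hbc (e i)

/-- Trace definability passes to elementary extensions of the defining structure. -/
theorem IsTrace.elementary {N' : Type u} [L.Structure N'] (e : N ↪ₑ[L] N') {s α : Type*} {τ : M → s → N}
    {X : Set (α → M)} (h : IsTrace L τ X) : IsTrace L (fun b i => e (τ b i)) X := by
  obtain ⟨Y, hY, rfl⟩ := h
  obtain ⟨m, φ, t, rfl⟩ := exists_eq_realize hY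
  refine ⟨_, definable_realize φ (fun i => Sum.map id e (t i)), ?_⟩
  ext a
  simp only [Set.mem_ofPred_eq]
  rw [← e.map_formula]
  apply iff_of_eq
  congr 1
  funext i
  simp only [Function.comp]
  rcases t i with x | b <;> rfl

theorem StrTraceDefines.elementary {L' : FirstOrder.Language.{u, u}} [L'.Structure M]
    (h : StrTraceDefines L N L' M) {N' : Type u} [L.Structure N'] (e : N ↪ₑ[L] N') :
    StrTraceDefines L N' L' M := by
  obtain ⟨n, τ, hτ, h⟩ := h
  refine ⟨n, fun b i => e (τ b i), fun b c hbc => hτ ?_, fun m X hX => ?_⟩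
  · funext i
    exact e.injective (congrFun hbc i)
  · exact IsTrace.elementary e (h m X hX)

theorem StrLocallyTraceDefines.elementary {L' : FirstOrder.Language.{u, u}} [L'.Structure M]
    (h : StrLocallyTraceDefines L N L' M) {N' : Type u} [L.Structure N'] (e : N ↪ₑ[L] N') :
    StrLocallyTraceDefines L N' L' M := by
  intro m X hX
  obtain ⟨n, τ, hτ, h⟩ := h m X hX
  refine ⟨n, fun b i => e (τ b i), fun b c hbc => hτ ?_, IsTrace.elementary e h⟩
  funext i
  exact e.injective (congrFun hbc i)

variable (L N) in
theorem StrTraceDefines.refl : StrTraceDefines L N L N := by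
  refine strTraceDefines_of_finite L N L (s := Unit) (fun b _ => b) (fun b c h => congrFun h ()) ?_
  intro m X hX
  exact ⟨_, definable_preimage_subst hX (fun i => Sum.inl (i, ())), by ext; simp [Function.comp_def]⟩

theorem StrTraceDefines.trans {O : Type u} {L' L'' : FirstOrder.Language.{u, u}} [L'.Structure M] [L''.Structure O]
    (h : StrTraceDefines L N L' M) (h' : StrTraceDefines L' M L'' O) : StrTraceDefines L N L'' O := by
  obtain ⟨n, τ, hτ, h⟩ := h
  obtain ⟨n', σ, hσ, h'⟩ := h'
  refine strTraceDefines_of_finite L N L'' (fun o (p : Fin n' × Fin n) => τ (σ o p.1) p.2) ?_ ?_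
  · intro a b hab
    exact hσ (funext fun i => hτ (funext fun j => congrFun hab (i, j)))
  · intro m X hX
    exact IsTrace.comp (h' m X hX) h

theorem StrLocallyTraceDefines.refl (L : FirstOrder.Language.{u, u}) (N : Type u) [L.Structure N] :
    StrLocallyTraceDefines L N L N := by
  intro m X hX
  obtain ⟨n, τ, hτ, h⟩ := StrTraceDefines.refl L N
  exact ⟨n, τ, hτ, h m X hX⟩

/-- One set is treated at a time, so `τ` may depend on the formula that defines the intermediate set
in `M`. -/
theorem StrLocallyTraceDefines.trans {O : Type u} {L' L'' : FirstOrder.Language.{u, u}} [L'.Structure M]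
    [L''.Structure O] (h : StrLocallyTraceDefines L N L' M) (h' : StrLocallyTraceDefines L' M L'' O) :
    StrLocallyTraceDefines L N L'' O := by
  intro m X hX
  obtain ⟨n, σ, hσ, Y, hY, rfl⟩ := h' m X hX
  obtain ⟨d, φ, t, rfl⟩ := exists_eq_realize hY
  obtain ⟨l, τ, hτ, hZ⟩ := h d {a | φ.Realize a} (definable_formula φ)
  obtain ⟨Z, hZ, e⟩ := IsTrace.subst (α := Fin m × Fin n) hZ t
  let c : Fin n × Fin l ≃ Fin (n * l) := finProdFinEquiv
  refine ⟨n * l, fun o i => τ (σ o (c.symm i).1) (c.symm i).2, fun a b hab => hσ ?_, _,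
    definable_preimage_subst hZ (fun p : (Fin m × Fin n) × Fin l => Sum.inl (p.1.1, c (p.1.2, p.2))), ?_⟩
  · refine funext fun i => hτ (funext fun j => ?_)
    simpa using congrFun hab (c (i, j))
  · ext a
    simp only [Set.mem_ofPred_eq]
    have := Set.ext_iff.1 e (fun p : Fin m × Fin n => σ (a p.1) p.2)
    simp only [Set.mem_ofPred_eq] at this
    rw [this]
    apply iff_of_eq
    congr 1
    funext p
    simp

end Trace

/-! ### Changing the defined structure to an elementarily equivalent one -/

section Ultrapower

/-- The existential closure of `φ` transfers; variables that are not free in `φ` receive an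
arbitrary value. -/
theorem exists_realize_of_elementarilyEquivalent {L : FirstOrder.Language.{u, u}} {M M' : Type u} [L.Structure M]
    [L.Structure M'] [Nonempty M] (h : M ≅[L] M') {α : Type*} (φ : L.Formula α) (v : α → M')
    (hv : φ.Realize v) : ∃ w : α → M, φ.Realize w := by
  classical
  have h1 : M' ⊨ φ.exClosure := by
    rw [Formula.realize_exClosure]
    exact ⟨fun a => v a, (BoundedFormula.realize_restrictFreeVar (φ := φ) (f := id) (v := fun a => v a)
      v (by simp)).2 hv⟩
  have h2 : M ⊨ φ.exClosure := (h.realize_sentence _).2 h1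
  rw [Formula.realize_exClosure] at h2
  obtain ⟨w, hw⟩ := h2
  refine ⟨fun a => if ha : a ∈ φ.freeVarFinset then w ⟨a, ha⟩ else Classical.arbitrary M, ?_⟩
  exact (BoundedFormula.realize_restrictFreeVar (φ := φ) (f := id) (v := w) _ (by simp)).1 hw

/-- Frayne's argument: the indices are the formulas true in `M'`, with elements of `M'` as
variables. Each is satisfied in `M` by some assignment, and conjunction makes the sets `S φ`
directed, so an ultrafilter contains them all. The maps `g j` thus assemble to an elementary map
from `M'` to an ultrapower of `M`. -/
theorem exists_ultrafilter_approximation {L : FirstOrder.Language.{u, u}} {M M' : Type u} [L.Structure M]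
    [L.Structure M'] [Nonempty M] (h : M ≅[L] M') :
    ∃ (J : Type u) (U : Ultrafilter J) (g : J → M' → M),
      ∀ φ : L.Formula M', φ.Realize id → ∀ᶠ j in U, φ.Realize (g j) := by
  let J := {φ : L.Formula M' // φ.Realize id}
  choose g hg using fun φ : J => exists_realize_of_elementarilyEquivalent h φ.1 id φ.2
  let S : J → Set J := fun φ => {ψ | φ.1.Realize (g ψ)}
  have : Nonempty J := ⟨⟨⊤, by simp⟩⟩
  have hne : (⨅ φ : J, Filter.principal (S φ)).NeBot := by
    apply Filter.iInf_neBot_of_directed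
    · intro φ ψ
      refine ⟨⟨φ.1 ⊓ ψ.1, by simpa using ⟨φ.2, ψ.2⟩⟩, ?_, ?_⟩ <;>
      · simp only [ge_iff_le, Filter.le_principal_iff, Filter.mem_principal]
        intro χ hχ
        simp only [S, Set.mem_ofPred_eq, Formula.realize_inf] at hχ ⊢
        first | exact hχ.1 | exact hχ.2
    · intro φ
      exact Filter.principal_neBot_iff.2 ⟨φ, hg φ⟩
  refine ⟨J, @Ultrafilter.of _ _ hne, g, fun φ hφ => ?_⟩
  have h1 : S ⟨φ, hφ⟩ ∈ (⨅ φ : J, Filter.principal (S φ)) :=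
    Filter.mem_iInf_of_mem _ (Filter.mem_principal_self _)
  exact (@Ultrafilter.of_le _ _ hne) h1

variable {L L' : FirstOrder.Language.{u, u}} {M M' N : Type u} [L'.Structure M] [L'.Structure M'] [L.Structure N]
  {J : Type u} {U : Ultrafilter J} {g : J → M' → M}

/-- Truth of `φ` at `a` means truth at `g j ∘ a` for almost all `j` (apply `hg` to `φ` and to its
negation); there it is expressed by `ψ` in `N`, and Łoś's theorem moves `ψ` to the ultrapower, its
parameters becoming constant sequences. -/
theorem IsTrace.ultrapower [Nonempty N]
    (hg : ∀ φ : L'.Formula M', φ.Realize id → ∀ᶠ j in U, φ.Realize (g j))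
    {s : Type*} {τ : M → s → N} {α : Type*} (φ : L'.Formula α) (h : IsTrace L τ {a | φ.Realize a}) :
    IsTrace L (N := (U : Filter J).Product (fun _ => N))
      (fun b i => ((fun j => τ (g j b) i : J → N) : (U : Filter J).Product (fun _ => N)))
      {a : α → M' | φ.Realize a} := by
  obtain ⟨Y, hY, e⟩ := h
  obtain ⟨m, ψ, t, rfl⟩ := exists_eq_realize hY
  refine ⟨_, definable_realize ψ
    (fun i => Sum.map id (fun b => ((fun _ => b : J → N) : (U : Filter J).Product (fun _ => N))) (t i)), ?_⟩
  ext a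
  simp only [Set.mem_ofPred_eq]
  have key : ∀ j, φ.Realize (g j ∘ a) ↔
      ψ.Realize (Sum.elim (fun p : α × s => τ (g j (a p.1)) p.2) id ∘ t) :=
    fun j => Set.ext_iff.1 e (g j ∘ a)
  have e1 : φ.Realize a ↔ ∀ᶠ j in U, φ.Realize (g j ∘ a) := by
    constructor
    · intro h1
      have := hg (φ.relabel a) (by simpa [Formula.realize_relabel] using h1)
      simpa [Formula.realize_relabel] using this
    · intro h1
      by_contra h2
      have := hg (φ.relabel a).not (by simpa [Formula.realize_relabel] using h2)
      simp only [Formula.realize_not, Formula.realize_relabel] at this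
      obtain ⟨j, hj1, hj2⟩ := (h1.and this).exists
      exact hj2 hj1
  rw [e1]
  simp only [key]
  rw [← Ultraproduct.realize_formula_cast (M := fun _ : J => N) ψ
    (fun i j => (Sum.elim (fun p : α × s => τ (g j (a p.1)) p.2) id ∘ t) i)]
  apply iff_of_eq
  congr 1
  funext i
  simp only [Function.comp]
  rcases t i with x | b <;> rfl

/-- As `s` is finite, agreement of each coordinate for almost all `j` gives agreement of the whole
tuples for almost all `j`. -/
theorem injective_ultrapower
    (hg : ∀ φ : L'.Formula M', φ.Realize id → ∀ᶠ j in U, φ.Realize (g j))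
    {s : Type*} [Finite s] {τ : M → s → N} (hτ : Function.Injective τ) :
    Function.Injective (fun (b : M') (i : s) =>
      ((fun j => τ (g j b) i : J → N) : (U : Filter J).Product (fun _ => N))) := by
  intro b c hbc
  by_contra hne
  have h1 := hg ((Term.var b).equal (Term.var c)).not (by simpa [Formula.realize_equal] using hne)
  have h2 : ∀ᶠ j in U, ∀ i, τ (g j b) i = τ (g j c) i := by
    rw [Filter.eventually_all]
    intro i
    exact Quotient.exact (congrFun hbc i)
  obtain ⟨j, hj1, hj2⟩ := (h1.and h2).exists
  exact (Formula.realize_not.1 hj1) (Formula.realize_equal.2 (hτ (funext hj2)))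

theorem StrTraceDefines.exists_of_elementarilyEquivalent [Nonempty N] [Nonempty M] (h : StrTraceDefines L N L' M)
    (hM : M ≅[L'] M') :
    ∃ (N' : Type u) (_ : L.Structure N') (_ : Nonempty N'), (∀ φ : L.Sentence, N ⊨ φ → N' ⊨ φ) ∧
      StrTraceDefines L N' L' M' := by
  obtain ⟨J, U, g, hg⟩ := exists_ultrafilter_approximation hM
  obtain ⟨n, τ, hτ, h⟩ := h
  refine ⟨(U : Filter J).Product (fun _ => N), inferInstance, inferInstance, fun φ hφ => ?_, ?_⟩
  · rw [Ultraproduct.sentence_realize]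
    exact Filter.Eventually.of_forall fun _ => hφ
  · refine ⟨n, _, injective_ultrapower hg hτ, fun m X hX => ?_⟩
    exact isTrace_of_formula (fun m φ => IsTrace.ultrapower hg φ (h m _ (definable_formula φ))) hX

theorem StrLocallyTraceDefines.exists_of_elementarilyEquivalent [Nonempty N] [Nonempty M]
    (h : StrLocallyTraceDefines L N L' M) (hM : M ≅[L'] M') :
    ∃ (N' : Type u) (_ : L.Structure N') (_ : Nonempty N'), (∀ φ : L.Sentence, N ⊨ φ → N' ⊨ φ) ∧
      StrLocallyTraceDefines L N' L' M' := by
  obtain ⟨J, U, g, hg⟩ := exists_ultrafilter_approximation hM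
  refine ⟨(U : Filter J).Product (fun _ => N), inferInstance, inferInstance, fun φ hφ => ?_, ?_⟩
  · rw [Ultraproduct.sentence_realize]
    exact Filter.Eventually.of_forall fun _ => hφ
  · intro m X hX
    obtain ⟨d, φ, t, rfl⟩ := exists_eq_realize hX
    obtain ⟨n, τ, hτ, hZ⟩ := h d {a | φ.Realize a} (definable_formula φ)
    exact ⟨n, _, injective_ultrapower hg hτ, (IsTrace.ultrapower hg φ hZ).subst t⟩

end Ultrapower

/-! ### Trace definability between theories -/

section Theories

variable {L L' L'' : FirstOrder.Language.{u, u}} {T : L.Theory} {T' : L'.Theory} {T'' : L''.Theory}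

/-- Models of a complete theory are elementarily equivalent, and the ultrapower used to change the
defined model is still a model of `T`. -/
theorem TraceDefines.exists_model (h : TraceDefines T T') (hT' : T'.IsMaximal)
    (M' : Theory.ModelType.{u, u, u} T') : ∃ N : Theory.ModelType.{u, u, u} T, StrTraceDefines L N L' M' := by
  obtain ⟨M, N, h⟩ := h
  obtain ⟨N', _, _, h1, h2⟩ := h.exists_of_elementarilyEquivalent
    (Theory.IsComplete.models_elementarily_equivalent hT'.isComplete M M')
  have : N' ⊨ T := Theory.model_iff _ |>.2 fun φ hφ => h1 φ (Theory.realize_sentence_of_mem T hφ)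
  exact ⟨Theory.ModelType.of T N', h2⟩

theorem LocallyTraceDefines.exists_model (h : LocallyTraceDefines T T') (hT' : T'.IsMaximal)
    (M' : Theory.ModelType.{u, u, u} T') :
    ∃ N : Theory.ModelType.{u, u, u} T, StrLocallyTraceDefines L N L' M' := by
  obtain ⟨M, N, h⟩ := h
  obtain ⟨N', _, _, h1, h2⟩ := h.exists_of_elementarilyEquivalent
    (Theory.IsComplete.models_elementarily_equivalent hT'.isComplete M M')
  have : N' ⊨ T := Theory.model_iff _ |>.2 fun φ hφ => h1 φ (Theory.realize_sentence_of_mem T hφ)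
  exact ⟨Theory.ModelType.of T N', h2⟩

theorem TraceDefines.refl (hT : T.IsMaximal) : TraceDefines T T := by
  obtain ⟨M⟩ := hT.1
  exact ⟨M, M, StrTraceDefines.refl L M⟩

theorem LocallyTraceDefines.refl (hT : T.IsMaximal) : LocallyTraceDefines T T := by
  obtain ⟨M⟩ := hT.1
  exact ⟨M, M, StrLocallyTraceDefines.refl L M⟩

theorem TraceDefines.trans (hT' : T'.IsMaximal) (h : TraceDefines T T') (h' : TraceDefines T' T'') :
    TraceDefines T T'' := by
  obtain ⟨O, M, h'⟩ := h'
  obtain ⟨N, h⟩ := h.exists_model hT' M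
  exact ⟨O, N, h.trans h'⟩

theorem LocallyTraceDefines.trans (hT' : T'.IsMaximal) (h : LocallyTraceDefines T T')
    (h' : LocallyTraceDefines T' T'') : LocallyTraceDefines T T'' := by
  obtain ⟨O, M, h'⟩ := h'
  obtain ⟨N, h⟩ := h.exists_model hT' M
  exact ⟨O, N, h.trans h'⟩

end Theories

/-! ### Rich families: one point extensions and existence -/

section Rich

variable {I P M : Type u} {k : ℕ}

/-- Richness for extensions by a single point, without the finite structure of values. -/
def OnePointRich (f : I → (Fin k → P) → M) : Prop :=
  ∀ (J : Finset I) (r : ℕ) (p : Fin r → P), Function.Injective p →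
    ∀ z : J → (Fin k → Option (Fin r)) → M, ∃ x : P, (∀ c, x ≠ p c) ∧
      ∀ (i : J) (c : Fin k → Option (Fin r)), none ∈ Set.range c →
        f i (fun l => (c l).elim x p) = z i c

/-- For `Y` take the finite set of all values involved: the actual ones at tuples from `p`, the
prescribed ones at tuples through the new point. -/
theorem Rich.onePointRich {f : I → (Fin k → P) → M} (hf : Rich f) : OnePointRich f := by
  classical
  intro J r p hp z
  let z' : J → (Fin k → Option (Fin r)) → M := fun i c =>
    if h : ∃ c' : Fin k → Fin r, c = fun l => some (c' l) then f i (fun l => p (h.choose l)) else z i c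
  have hS : (Set.range fun w : J × (Fin k → Option (Fin r)) => z' w.1 w.2).Finite := Set.finite_range _
  obtain ⟨n, ⟨e⟩⟩ := hS.exists_equiv_fin
  let A : Set (Option (Fin r)) := {c | c ≠ none}
  let p₀ : A ↪ P := ⟨fun a => p (a.1.get (Option.ne_none_iff_isSome.1 a.2)), fun a b hab => by
    have := hp hab
    exact Subtype.ext (Option.get_inj.1 this)⟩
  let q : Fin n ↪ M := ⟨fun y => (e.symm y).1, fun a b hab => e.symm.injective (Subtype.ext hab)⟩
  let σ : J → (Fin k → Option (Fin r)) → Fin n := fun i c => e ⟨z' i c, (i, c), rfl⟩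
  have hqσ : ∀ i c, q (σ i c) = z' i c := fun i c =>
    congrArg Subtype.val (e.symm_apply_apply _)
  obtain ⟨p', h1, h2⟩ := hf J (Option (Fin r)) (Fin n) σ A p₀ q (by
    intro i a
    rw [hqσ]
    have h : ∃ c' : Fin k → Fin r, (fun l => (a l : Option (Fin r))) = fun l => some (c' l) :=
      ⟨fun l => (a l).1.get (Option.ne_none_iff_isSome.1 (a l).2), by simp⟩
    simp only [z', dif_pos h]
    congr 1
    funext l
    change p _ = p _
    congr 1
    apply Option.some_injective
    rw [Option.some_get]
    exact congrFun h.choose_spec l)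
  have h3 : ∀ c, p' (some c) = p c := fun c => h1 ⟨some c, by simp [A]⟩
  refine ⟨p' none, fun c hc => ?_, fun i c hc => ?_⟩
  · rw [← h3] at hc
    cases p'.injective hc
  · have h4 : ¬ ∃ c' : Fin k → Fin r, c = fun l => some (c' l) := by
      rintro ⟨c', rfl⟩
      obtain ⟨l, hl⟩ := hc
      cases hl
    have := h2 i c
    rw [hqσ] at this
    simp only [z', dif_neg h4] at this
    rw [← this]
    congr 1
    funext l
    rcases c l with _ | d
    · rfl
    · exact (h3 d).symm

theorem OnePointRich.exists_point {f : I → (Fin k → P) → M} (hf : OnePointRich f) (J : Finset I)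
    {A : Type*} [Finite A] {p : A → P} (hp : Function.Injective p) (z : J → (Fin k → Option A) → M) :
    ∃ x : P, (∀ a, x ≠ p a) ∧ ∀ (i : J) (c : Fin k → Option A), none ∈ Set.range c →
      f i (fun l => (c l).elim x p) = z i c := by
  obtain ⟨r, ⟨e⟩⟩ := Finite.exists_equiv_fin A
  obtain ⟨x, h1, h2⟩ := hf J r (p ∘ e.symm) (hp.comp e.symm.injective)
    (fun i c => z i (fun l => (c l).map e.symm))
  refine ⟨x, fun a => by simpa using h1 (e a), fun i c hc => ?_⟩
  have := h2 i (fun l => (c l).map e) (by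
    obtain ⟨l, hl⟩ := hc
    exact ⟨l, by simp [hl]⟩)
  simp only [Option.map_map, Equiv.symm_comp_self, Option.map_id, id] at this
  rw [← this]
  congr 1
  funext l
  rcases c l with _ | d <;> simp

/-- If `P` were finite, all of it could serve as the given tuple, and no new point would be left. -/
theorem OnePointRich.infinite [Nonempty M] {f : I → (Fin k → P) → M} (hf : OnePointRich f) : Infinite P := by
  by_contra h
  rw [not_infinite_iff_finite] at h
  obtain ⟨m⟩ := ‹Nonempty M›
  obtain ⟨x, hx, -⟩ := hf.exists_point ∅ (p := (id : P → P)) Function.injective_id (fun _ _ => m)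
  exact hx x rfl

/-- The points of `X` outside `A` are added one at a time; at each stage the values dictated by `q ∘
σ` are prescribed on the tuples through the new point, and the other tuples are covered by
induction. -/
theorem OnePointRich.rich [Nonempty M] {f : I → (Fin k → P) → M} (hf : OnePointRich f) : Rich f := by
  classical
  intro J X Y _ _ σ A p q h
  obtain ⟨x₀⟩ : Nonempty P := hf.infinite.nonempty
  have key : ∀ S : Set X, S.Finite → ∃ p' : X → P, Set.InjOn p' (A ∪ S) ∧ (∀ a : A, p' a = p a) ∧
      ∀ (i : J) (a : Fin k → X), (∀ l, a l ∈ A ∪ S) → f i (fun l => p' (a l)) = q (σ i a) := by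
    intro S hS
    induction S, hS using Set.Finite.induction_on with
    | empty =>
      have e : ∀ a : A, (if hx : (a : X) ∈ A then p ⟨a, hx⟩ else x₀) = p a := fun a => by simp
      -- The default `x₀` is harmless, because the claim only concerns `A ∪ S`.
      refine ⟨fun x => if hx : x ∈ A then p ⟨x, hx⟩ else x₀, ?_, e, ?_⟩
      · rw [Set.union_empty]
        intro a ha b hb hab
        simp only [dif_pos ha, dif_pos hb] at hab
        exact congrArg Subtype.val (p.injective hab)
      · intro i a ha
        simp only [Set.union_empty] at ha
        rw [← h i (fun l => ⟨a l, ha l⟩)]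
        congr 1
        funext l
        exact e ⟨a l, ha l⟩
    | @insert x S _ _ ih =>
      obtain ⟨p', hinj, hp', hf'⟩ := ih
      by_cases hx : x ∈ A ∪ S
      · have : A ∪ insert x S = A ∪ S := by
          ext y
          simp only [Set.mem_union, Set.mem_insert_iff] at hx ⊢
          constructor
          · rintro (h | rfl | h)
            exacts [Or.inl h, hx, Or.inr h]
          · rintro (h | h)
            exacts [Or.inl h, Or.inr (Or.inr h)]
        rw [this]
        exact ⟨p', hinj, hp', hf'⟩
      · obtain ⟨y, hy1, hy2⟩ := hf.exists_point J (A := ↥(A ∪ S)) (p := fun a => p' a)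
          (fun a b hab => Subtype.ext (hinj a.2 b.2 hab))
          (fun i c => q (σ i (fun l => (c l).elim x Subtype.val)))
        have hu : ∀ z ∈ A ∪ S, Function.update p' x y z = p' z := fun z hz =>
          Function.update_of_ne (fun h : z = x => hx (h ▸ hz)) _ _
        have hmem : ∀ z, z ∈ A ∪ insert x S → z = x ∨ z ∈ A ∪ S := by
          intro z
          simp only [Set.mem_union, Set.mem_insert_iff]
          tauto
        refine ⟨Function.update p' x y, ?_, fun a => ?_, fun i a ha => ?_⟩
        · intro a ha b hb hab
          rcases hmem a ha with rfl | ha' <;> rcases hmem b hb with rfl | hb'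
          · rfl
          · rw [Function.update_self, hu b hb'] at hab
            exact absurd hab (hy1 ⟨b, hb'⟩)
          · rw [Function.update_self, hu a ha'] at hab
            exact absurd hab.symm (hy1 ⟨a, ha'⟩)
          · rw [hu a ha', hu b hb'] at hab
            exact hinj ha' hb' hab
        · rw [hu _ (Or.inl a.2), hp']
        · by_cases hxa : ∃ l, a l = x
          -- In `c`, `none` marks the occurrences of the new point in the tuple `a`.
          · let c : Fin k → Option ↥(A ∪ S) := fun l =>
              if hl : a l = x then none else some ⟨a l, (hmem _ (ha l)).resolve_left hl⟩
            have hc := hy2 i c (by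
              obtain ⟨l, hl⟩ := hxa
              exact ⟨l, by simp [c, hl]⟩)
            have e1 : (fun l => (c l).elim x Subtype.val) = a := by
              funext l
              by_cases hl : a l = x <;> simp [c, hl]
            rw [e1] at hc
            rw [← hc]
            congr 1
            funext l
            by_cases hl : a l = x
            · simp [c, hl]
            · simp [c, hl]
          · push Not at hxa
            have ha' : ∀ l, a l ∈ A ∪ S := fun l => (hmem _ (ha l)).resolve_left (hxa l)
            rw [← hf' i a ha']
            congr 1
            funext l
            exact hu _ (ha' l)
  obtain ⟨p', hinj, hp', hf'⟩ := key Set.univ Set.finite_univ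
  simp only [Set.union_univ, Set.mem_univ, implies_true, forall_const] at hinj hf'
  exact ⟨⟨p', fun a b hab => hinj trivial trivial hab⟩, hp', hf'⟩

/-- The points freely generated from `Q` by adding, for every finite tuple of points and every
prescription of values in `M` on the tuples involving the new point, a point with these values. -/
inductive FreePoint (Q M I : Type u) (k : ℕ) : Type u
  | base (b : Q) : FreePoint Q M I k
  | new (r : ℕ) (a : Fin r → FreePoint Q M I k) (z : I → (Fin k → Option (Fin r)) → M) : FreePoint Q M I k

namespace FreePoint

variable {Q : Type u}

/-- The number of generations needed to construct a point. -/
def depth : FreePoint Q M I k → ℕ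
  | base _ => 0
  | new _ a _ => (Finset.univ.sup fun c => depth (a c)) + 1

theorem depth_lt (r : ℕ) (a : Fin r → FreePoint Q M I k) (z : I → (Fin k → Option (Fin r)) → M) (c : Fin r) :
    depth (a c) < depth (new r a z) := by
  rw [depth]
  exact Nat.lt_succ_of_le (Finset.le_sup (f := fun c => depth (a c)) (Finset.mem_univ c))

/-- The value `m` is prescribed for the function with index `i` at the tuple `p`. -/
def Prescribed (i : I) (p : Fin k → FreePoint Q M I k) (m : M) : Prop :=
  ∃ (r : ℕ) (a : Fin r → FreePoint Q M I k) (z : I → (Fin k → Option (Fin r)) → M)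
    (c : Fin k → Option (Fin r)), Function.Injective a ∧ none ∈ Set.range c ∧
      (p = fun l => (c l).elim (new r a z) a) ∧ m = z i c

/-- The new point of a prescribed tuple is deeper than all its other entries. Two candidates for it
would each precede the other, contradicting depth; once it is known, so are `a` and `z`, and
injectivity of `a` recovers `c`. -/
theorem Prescribed.unique {i : I} {p : Fin k → FreePoint Q M I k} {m m' : M}
    (h : Prescribed i p m) (h' : Prescribed i p m') : m = m' := by
  obtain ⟨r, a, z, c, ha, ⟨l, hl⟩, rfl, rfl⟩ := h
  obtain ⟨r', a', z', c', ha', ⟨l', hl'⟩, e, rfl⟩ := h'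
  have e1 := congrFun e l
  have e2 := congrFun e l'
  simp only [hl, hl', Option.elim_none] at e1 e2
  have key : new r a z = new r' a' z' := by
    rcases h1 : c' l with _ | d
    · rw [h1] at e1
      exact e1
    · rcases h2 : c l' with _ | d'
      · rw [h2] at e2
        exact e2
      · rw [h1] at e1
        rw [h2] at e2
        simp only [Option.elim_some] at e1 e2
        have := depth_lt r a z d'
        have := depth_lt r' a' z' d
        rw [e1, ← e2] at *
        omega
  cases key
  congr 1
  funext j
  have e3 := congrFun e j
  rcases hj : c j with _ | d <;> rcases hj' : c' j with _ | d'
  · rfl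
  · simp only [hj, hj', Option.elim_none, Option.elim_some] at e3
    have := depth_lt r a z d'
    rw [← e3] at this
    exact absurd this (lt_irrefl _)
  · simp only [hj, hj', Option.elim_none, Option.elim_some] at e3
    have := depth_lt r a z d
    rw [e3] at this
    exact absurd this (lt_irrefl _)
  · simp only [hj, hj', Option.elim_some] at e3
    rw [ha e3]

open Classical in
/-- The generic functions on `FreePoint` extending `e`. -/
noncomputable def fn [Nonempty M] (e : I → (Fin k → Q) → M) (i : I) (p : Fin k → FreePoint Q M I k) : M :=
  if h : ∃ m, Prescribed i p m then h.choose
  else if h : ∃ b : Fin k → Q, p = fun l => base (b l) then e i h.choose else Classical.arbitrary M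

theorem fn_eq [Nonempty M] (e : I → (Fin k → Q) → M) {i : I} {p : Fin k → FreePoint Q M I k} {m : M}
    (h : Prescribed i p m) : fn e i p = m := by
  have h' : ∃ m, Prescribed i p m := ⟨m, h⟩
  rw [fn, dif_pos h']
  exact h'.choose_spec.unique h

theorem fn_base [Nonempty M] (e : I → (Fin k → Q) → M) (i : I) (b : Fin k → Q) :
    fn e i (fun l => base (b l)) = e i b := by
  have h1 : ¬ ∃ m, Prescribed i (fun l => (base (b l) : FreePoint Q M I k)) m := by
    rintro ⟨m, r, a, z, c, -, ⟨l, hl⟩, h, -⟩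
    have := congrFun h l
    simp only [hl, Option.elim_none] at this
    cases this
  have h2 : ∃ b' : Fin k → Q, (fun l => (base (b l) : FreePoint Q M I k)) = fun l => base (b' l) := ⟨b, rfl⟩
  rw [fn, dif_neg h1, dif_pos h2]
  congr 1
  funext l
  have := congrFun h2.choose_spec l
  exact (FreePoint.base.inj this).symm

/-- The required point exists by construction as a `new` point; the prescription is extended
arbitrarily to indices outside `J`. -/
theorem onePointRich_fn [Nonempty M] (e : I → (Fin k → Q) → M) : OnePointRich (fn e) := by
  classical
  intro J r p hp z
  refine ⟨new r p (fun i c => if hi : i ∈ J then z ⟨i, hi⟩ c else Classical.arbitrary M), fun c hc => ?_,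
    fun i c hc => fn_eq e ⟨r, p, _, c, hp, hc, rfl, by simp⟩⟩
  have := depth_lt r p (fun i c => if hi : i ∈ J then z ⟨i, hi⟩ c else Classical.arbitrary M) c
  rw [hc] at this
  exact lt_irrefl _ this

end FreePoint

/-- Every family of functions extends to a rich one. -/
theorem exists_rich_extension [Nonempty M] {Q : Type u} (e : I → (Fin k → Q) → M) :
    ∃ (P : Type u) (ι : Q → P) (f : I → (Fin k → P) → M), Function.Injective ι ∧ Rich f ∧ Infinite P ∧
      ∀ i b, f i (fun l => ι (b l)) = e i b :=
  ⟨FreePoint Q M I k, FreePoint.base, FreePoint.fn e, fun _ _ h => FreePoint.base.inj h,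
    (FreePoint.onePointRich_fn e).rich, (FreePoint.onePointRich_fn e).infinite, FreePoint.fn_base e⟩

end Rich

/-! ### Rich structures as one-sorted structures on `P ⊕ M` -/

section Generic

variable {L : FirstOrder.Language.{u, u}} {I : Type u} {k : ℕ}

/-- The set `P ⊕ M`, carrying the structure `genStructure L f`. -/
def GenModel (L : FirstOrder.Language.{u, u}) {I P M : Type u} [L.Structure M] {k : ℕ}
    (_ : I → (Fin k → P) → M) : Type u := P ⊕ M

instance GenModel.instStructure {P M : Type u} [L.Structure M] (f : I → (Fin k → P) → M) :
    (genLang L I k).Structure (GenModel L f) := genStructure L f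

instance GenModel.instNonempty {P M : Type u} [L.Structure M] [h : Nonempty M] (f : I → (Fin k → P) → M) :
    Nonempty (GenModel L f) := h.map Sum.inr

theorem exists_var_eq {γ : Type*} (t : (genLang L I k).Term γ) : ∃ x, t = Term.var x := by
  rcases t with x | ⟨g, _⟩
  · exact ⟨x, rfl⟩
  · exact PEmpty.elim g

/-! ### Elimination of the quantifiers over the rich sort -/

section Elimination

variable {A B : Type u}

/-- Conditions on tuples `p` in `P` and `m` in `M`, for structures `(P, M, f)`. -/
abbrev GenPred (L : FirstOrder.Language.{u, u}) (I : Type u) (k : ℕ) (A B : Type u) : Type (u + 1) :=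
  ∀ (P M : Type u) [L.Structure M], (I → (Fin k → P) → M) → (A → P) → (B → M) → Prop

/-- The condition `Φ` on injective tuples `p` in `P` and tuples `m` in `M` is given, in all rich
structures, by an `L`-formula satisfied by `m` and the values of the functions at `p`. -/
def Eliminable (Φ : GenPred L I k A B) :
    Prop :=
  ∃ (J : Finset I) (θ : L.Formula (B ⊕ J × (Fin k → A))),
    ∀ (P M : Type u) [L.Structure M] [Nonempty M] (f : I → (Fin k → P) → M), OnePointRich f →
      ∀ p : A → P, Function.Injective p → ∀ m : B → M,
        Φ P M f p m ↔ θ.Realize (Sum.elim m fun x => f x.1 fun l => p (x.2 l))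

variable {Φ Ψ : GenPred L I k A B}

theorem Eliminable.congr (h : Eliminable Φ)
    (h' : ∀ (P M : Type u) [L.Structure M] [Nonempty M] (f : I → (Fin k → P) → M), OnePointRich f →
      ∀ p : A → P, Function.Injective p → ∀ m : B → M, (Ψ P M f p m ↔ Φ P M f p m)) : Eliminable Ψ := by
  obtain ⟨J, θ, h⟩ := h
  exact ⟨J, θ, fun P M _ _ f hf p hp m => (h' P M f hf p hp m).trans (h P M f hf p hp m)⟩

/-- This brings several formulas to a common finite set of function indices before they are
combined. -/
theorem Eliminable.mono {J : Finset I} {θ : L.Formula (B ⊕ J × (Fin k → A))}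
    (h : ∀ (P M : Type u) [L.Structure M] [Nonempty M] (f : I → (Fin k → P) → M), OnePointRich f →
      ∀ p : A → P, Function.Injective p → ∀ m : B → M,
        Φ P M f p m ↔ θ.Realize (Sum.elim m fun x => f x.1 fun l => p (x.2 l)))
    {J' : Finset I} (hJ : J ⊆ J') :
    ∃ θ' : L.Formula (B ⊕ J' × (Fin k → A)),
      ∀ (P M : Type u) [L.Structure M] [Nonempty M] (f : I → (Fin k → P) → M), OnePointRich f →
      ∀ p : A → P, Function.Injective p → ∀ m : B → M,
        Φ P M f p m ↔ θ'.Realize (Sum.elim m fun x => f x.1 fun l => p (x.2 l)) := by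
  refine ⟨θ.relabel (Sum.map id fun x => (⟨x.1.1, hJ x.1.2⟩, x.2)), fun P M _ _ f hf p hp m => ?_⟩
  rw [h P M f hf p hp m, Formula.realize_relabel, Sum.elim_comp_map]
  rfl

theorem eliminable_formula (θ : L.Formula B) :
    Eliminable ((fun _ _ _ _ _ m => θ.Realize m) : GenPred L I k A B) :=
  ⟨∅, θ.relabel Sum.inl, fun P M _ _ f _ p _ m => by rw [Formula.realize_relabel, Sum.elim_comp_inl]⟩

theorem eliminable_const (q : Prop) :
    Eliminable ((fun _ _ _ _ _ _ => q) : GenPred L I k A B) := by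
  by_cases h : q
  · exact (eliminable_formula ⊤).congr fun P M _ _ f _ p _ m => by simp [h]
  · exact (eliminable_formula ⊥).congr fun P M _ _ f _ p _ m => by simp [h]

theorem Eliminable.imp (h : Eliminable Φ) (h' : Eliminable Ψ) :
    Eliminable ((fun P M _ f p m => Φ P M f p m → Ψ P M f p m) : GenPred L I k A B) := by
  classical
  obtain ⟨J, θ, h⟩ := h
  obtain ⟨J', θ', h'⟩ := h'
  obtain ⟨χ, hχ⟩ := Eliminable.mono h (J' := J ∪ J') Finset.subset_union_left
  obtain ⟨χ', hχ'⟩ := Eliminable.mono h' (J' := J ∪ J') Finset.subset_union_right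
  refine ⟨J ∪ J', χ.imp χ', fun P M _ _ f hf p hp m => ?_⟩
  rw [Formula.realize_imp, ← hχ P M f hf p hp m, ← hχ' P M f hf p hp m]

theorem Eliminable.and (h : Eliminable Φ) (h' : Eliminable Ψ) :
    Eliminable ((fun P M _ f p m => Φ P M f p m ∧ Ψ P M f p m) : GenPred L I k A B) :=
  ((h.imp (h'.imp (eliminable_const False))).imp (eliminable_const False)).congr
    fun P M _ _ f _ p _ m => by tauto

theorem Eliminable.forall_finite {C : Type*} [Finite C]
    {Φ : C → GenPred L I k A B}
    (h : ∀ c, Eliminable (Φ c)) : Eliminable ((fun P M _ f p m => ∀ c, Φ c P M f p m) : GenPred L I k A B) := by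
  classical
  cases nonempty_fintype C
  choose J θ h using h
  choose χ hχ using fun c => Eliminable.mono (h c) (J' := Finset.univ.biUnion J)
    (Finset.subset_biUnion_of_mem J (Finset.mem_univ c))
  refine ⟨_, Formula.iInf χ, fun P M _ _ f hf p hp m => ?_⟩
  rw [Formula.realize_iInf]
  exact forall_congr' fun c => hχ c P M f hf p hp m

theorem Eliminable.forall_model
    {Φ : GenPred L I k A (Option B)}
    (h : Eliminable Φ) :
    Eliminable ((fun P M _ f p (m : B → M) => ∀ y : M, Φ P M f p (fun o => o.elim y m)) : GenPred L I k A B) := by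
  obtain ⟨J, θ, h⟩ := h
  refine ⟨J, Formula.iAlls Unit (θ.relabel
    (Sum.elim (fun o => o.elim (Sum.inr ()) fun b => Sum.inl (Sum.inl b)) fun x => Sum.inl (Sum.inr x))),
    fun P M _ _ f hf p hp m => ?_⟩
  simp only [h P M f hf p hp, Formula.realize_iAlls, Formula.realize_relabel]
  have e : ∀ i : Unit → M, (fun a => Sum.elim (Sum.elim m fun x : J × (Fin k → A) => f x.1 fun l => p (x.2 l)) i a) ∘
      (Sum.elim (fun o : Option B => o.elim (Sum.inr ()) fun b => Sum.inl (Sum.inl b)) fun x => Sum.inl (Sum.inr x)) =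
      Sum.elim (fun o => o.elim (i ()) m) fun x => f x.1 fun l => p (x.2 l) := by
    intro i
    funext o
    rcases o with (_ | b) | x <;> rfl
  simp only [e]
  exact ⟨fun h i => h (i ()), fun h y => h fun _ => y⟩

/-- The decisive step of the elimination. The map `s` splits the values at tuples from `Option A`
into those at old tuples, which stay free, and those at tuples through the new point (the elements
of `C`), which become universally quantified variables over `M`. -/
theorem Eliminable.forall_generic [Finite A]
    {Φ : GenPred L I k (Option A) B}
    (h : Eliminable Φ) :
    Eliminable ((fun P M _ f (p : A → P) m => ∀ x : P, (∀ a, x ≠ p a) → Φ P M f (fun o => o.elim x p) m) : GenPred L I k A B) := by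
  classical
  obtain ⟨J, θ, h⟩ := h
  let C := {c : Fin k → Option A // none ∈ Set.range c}
  let s : B ⊕ J × (Fin k → Option A) → (B ⊕ J × (Fin k → A)) ⊕ (J × C) :=
    Sum.elim (fun b => Sum.inl (Sum.inl b)) fun x =>
      if hc : none ∈ Set.range x.2 then Sum.inr (x.1, ⟨x.2, hc⟩)
      else Sum.inl (Sum.inr (x.1, fun l => (x.2 l).get (Option.ne_none_iff_isSome.1 fun h => hc ⟨l, h⟩)))
  refine ⟨J, Formula.iAlls (J × C) (θ.relabel s), fun P M _ _ f hf p hp m => ?_⟩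
  have hinj : ∀ x, (∀ a, x ≠ p a) → Function.Injective fun o : Option A => o.elim x p := by
    rintro x hx (_ | a) (_ | b) hab
    · rfl
    · exact absurd hab (hx b)
    · exact absurd hab.symm (hx a)
    · exact congrArg some (hp hab)
  have e : ∀ (x : P) (z : J × C → M),
      (∀ (i : J) (c : C), f i (fun l => (c.1 l).elim x p) = z (i, c)) →
      (Sum.elim (Sum.elim m fun x : J × (Fin k → A) => f x.1 fun l => p (x.2 l)) z) ∘ s =
      Sum.elim m fun y => f y.1 fun l => (y.2 l).elim x p := by
    intro x z hz
    funext o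
    rcases o with b | ⟨i, c⟩
    · rfl
    · by_cases hc : none ∈ Set.range c
      · simp only [Function.comp, s, Sum.elim_inr, dif_pos hc]
        exact (hz i ⟨c, hc⟩).symm
      · simp only [Function.comp, s, Sum.elim_inr, dif_neg hc, Sum.elim_inl]
        congr 1
        funext l
        have hl : c l ≠ none := fun h => hc ⟨l, h⟩
        obtain ⟨a, ha⟩ := Option.ne_none_iff_exists'.1 hl
        simp [ha]
  simp only [Formula.realize_iAlls, Formula.realize_relabel]
  constructor
  · intro h1 z
    -- Richness is used here: an arbitrary assignment `z` to the quantified variables is attained at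
    -- some new point.
    obtain ⟨x, hx, hz⟩ := hf.exists_point J hp
      (fun i c => if hc : none ∈ Set.range c then z (i, ⟨c, hc⟩) else Classical.arbitrary M)
    have h2 := (h P M f hf _ (hinj x hx) m).1 (h1 x hx)
    have := e x z (fun i c => by
      rw [hz i c.1 c.2, dif_pos c.2])
    rw [← this] at h2
    exact h2
  · intro h1 x hx
    rw [h P M f hf _ (hinj x hx) m, ← e x (fun y => f y.1 (fun l => (y.2.1 l).elim x p)) (fun i c => rfl)]
    exact h1 _

/-- The sorts of the variables being prescribed, an atom is constant (a sort predicate, or sorts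
that do not fit), or an atom about `M`, or an equation between a value of some `f i` and a variable.
-/
theorem eliminable_relMap {n : ℕ} (R : (genLang L I k).Relations n) (t : Fin n → A ⊕ B) :
    Eliminable ((fun _ _ _ f p m =>
      Structure.RelMap (M := GenModel L f) R (fun j => Sum.map p m (t j))) : GenPred L I k A B) := by
  classical
  cases R with
  | inP =>
    rcases ht : t 0 with a | b
    · refine (eliminable_const True).congr fun P M _ _ f _ p _ m => iff_true_intro ⟨p a, ?_⟩
      simp [ht]
    · refine (eliminable_const False).congr fun P M _ _ f _ p _ m => iff_false_intro ?_
      rintro ⟨x, hx⟩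
      simp [ht] at hx
  | inM =>
    rcases ht : t 0 with a | b
    · refine (eliminable_const False).congr fun P M _ _ f _ p _ m => iff_false_intro ?_
      rintro ⟨x, hx⟩
      simp [ht] at hx
    · refine (eliminable_const True).congr fun P M _ _ f _ p _ m => iff_true_intro ⟨m b, ?_⟩
      simp [ht]
  | @graph n g =>
    by_cases ht : ∃ c : Fin (n + 1) → B, ∀ j, t j = Sum.inr (c j)
    · obtain ⟨c, ht⟩ := ht
      refine (eliminable_formula (Term.equal (Term.func g (fun j => Term.var (c j.castSucc)))
        (Term.var (c (Fin.last n))))).congr fun P M _ _ f _ p _ m => ?_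
      rw [Formula.realize_equal]
      constructor
      · rintro ⟨x, h1, h2⟩
        simp only [ht, Sum.map_inr, Sum.inr.injEq] at h1 h2
        simp only [Term.realize_func, Term.realize_var, h1, h2]
      · intro h
        refine ⟨fun j => m (c j.castSucc), fun j => by simp [ht], ?_⟩
        simpa [ht] using h.symm
    · refine (eliminable_const False).congr fun P M _ _ f _ p _ m => iff_false_intro ?_
      rintro ⟨x, h1, h2⟩
      refine ht ?_
      have : ∀ j, ∃ b, t j = Sum.inr b := by
        intro j
        rcases hj : t j with a | b
        · exfalso
          induction j using Fin.lastCases with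
          | last => simp [hj] at h2
          | cast j =>
            have := h1 j
            simp [hj] at this
        · exact ⟨b, rfl⟩
      choose c hc using this
      exact ⟨c, hc⟩
  | @rel n R =>
    by_cases ht : ∃ c : Fin n → B, ∀ j, t j = Sum.inr (c j)
    · obtain ⟨c, ht⟩ := ht
      refine (eliminable_formula (Relations.formula R (fun j => Term.var (c j)))).congr
        fun P M _ _ f _ p _ m => ?_
      rw [Formula.realize_rel]
      constructor
      · rintro ⟨x, h1, h2⟩
        simp only [ht, Sum.map_inr, Sum.inr.injEq] at h1
        simpa only [Term.realize_var, h1] using h2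
      · intro h
        exact ⟨fun j => m (c j), fun j => by simp [ht], h⟩
    · refine (eliminable_const False).congr fun P M _ _ f _ p _ m => iff_false_intro ?_
      rintro ⟨x, h1, h2⟩
      refine ht ?_
      have : ∀ j, ∃ b, t j = Sum.inr b := by
        intro j
        rcases hj : t j with a | b
        · have := h1 j
          simp [hj] at this
        · exact ⟨b, rfl⟩
      choose c hc using this
      exact ⟨c, hc⟩
  | fn i =>
    by_cases ht : (∃ c : Fin k → A, ∀ j : Fin k, t j.castSucc = Sum.inl (c j)) ∧ ∃ b, t (Fin.last k) = Sum.inr b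
    · obtain ⟨⟨c, hc⟩, b, hb⟩ := ht
      refine ⟨{i}, Term.equal (Term.var (Sum.inr (⟨i, by simp⟩, c))) (Term.var (Sum.inl b)),
        fun P M _ _ f _ p _ m => ?_⟩
      rw [Formula.realize_equal]
      constructor
      · rintro ⟨x, h1, h2⟩
        simp only [hc, hb, Sum.map_inl, Sum.map_inr, Sum.inl.injEq, Sum.inr.injEq] at h1 h2
        simp only [Term.realize_var, Sum.elim_inl, Sum.elim_inr, h1, h2]
      · intro h
        refine ⟨fun j => p (c j), fun j => by simp [hc], ?_⟩
        simpa [hb] using h.symm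
    · refine (eliminable_const False).congr fun P M _ _ f _ p _ m => iff_false_intro ?_
      rintro ⟨x, h1, h2⟩
      refine ht ⟨?_, ?_⟩
      · have : ∀ j : Fin k, ∃ a, t j.castSucc = Sum.inl a := by
          intro j
          rcases hj : t j.castSucc with a | b
          · exact ⟨a, rfl⟩
          · have := h1 j
            simp [hj] at this
        choose c hc using this
        exact ⟨c, hc⟩
      · rcases hj : t (Fin.last k) with a | b
        · simp [hj] at h2
        · exact ⟨b, rfl⟩

/-- In rich structures, a formula in variables of prescribed sorts, where distinct variables of the
rich sort are assigned distinct values, is equivalent to an `L`-formula satisfied by the variables of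
the other sort and the values of the functions. -/
theorem eliminable_realize {α : Type*} {n : ℕ} (φ : (genLang L I k).BoundedFormula α n) :
    ∀ {A B : Type u} [Finite A] [Finite B] (w : α → A ⊕ B) (w' : Fin n → A ⊕ B),
      Eliminable ((fun _ _ _ f p m => φ.Realize (M := GenModel L f) (fun x => Sum.map p m (w x))
        (fun x => Sum.map p m (w' x))) : GenPred L I k A B) := by
  induction φ with
  | falsum => exact fun w w' => eliminable_const False
  | equal t₁ t₂ =>
    intro A B _ _ w w'
    obtain ⟨x₁, rfl⟩ := exists_var_eq t₁
    obtain ⟨x₂, rfl⟩ := exists_var_eq t₂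
    have e : ∀ (P M : Type u) (p : A → P) (m : B → M) x, Sum.elim (fun x => Sum.map p m (w x))
        (fun x => Sum.map p m (w' x)) x = Sum.map p m (Sum.elim w w' x) := by
      intro P M p m x
      rcases x with x | x <;> rfl
    have key : Eliminable ((fun P M _ f p m => Sum.map p m (Sum.elim w w' x₁) = Sum.map p m (Sum.elim w w' x₂))
        : GenPred L I k A B) := by
      rcases h1 : Sum.elim w w' x₁ with a | b <;> rcases h2 : Sum.elim w w' x₂ with a' | b'
      · refine (eliminable_const (a = a')).congr fun P M _ _ f _ p hp m => ?_
        simp [hp.eq_iff]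
      · exact (eliminable_const False).congr fun P M _ _ f _ p hp m => by simp
      · exact (eliminable_const False).congr fun P M _ _ f _ p hp m => by simp
      · refine (eliminable_formula ((Term.var b).equal (Term.var b'))).congr fun P M _ _ f _ p hp m => ?_
        rw [Formula.realize_equal]
        simp
    refine key.congr fun P M _ _ f _ p _ m => ?_
    rw [← e, ← e]
    rfl
  | rel R ts =>
    intro A B _ _ w w'
    choose x hx using fun j => exists_var_eq (ts j)
    refine (eliminable_relMap R (fun j => Sum.elim w w' (x j))).congr fun P M _ _ f _ p _ m => ?_
    apply iff_of_eq
    change Structure.RelMap R _ = _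
    congr 1
    funext j
    rw [hx j, Term.realize_var]
    rcases x j with x | x <;> rfl
  | imp _ _ h1 h2 => exact fun w w' => (h1 w w').imp (h2 w w')
  | @all n φ ih =>
    intro A B _ _ w w'
    -- The quantified element lies in `M`, or is one of the points `p a`, or is a new point of `P`;
    -- only the third case needs richness.
    have hM := (ih (A := A) (B := Option B) (fun x => Sum.map id some (w x))
      (Fin.snoc (α := fun _ => A ⊕ Option B) (fun x => Sum.map id some (w' x)) (Sum.inr none))).forall_model
    have hA := Eliminable.forall_finite fun a : A => ih w (Fin.snoc (α := fun _ => A ⊕ B) w' (Sum.inl a))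
    have hP := (ih (A := Option A) (B := B) (fun x => Sum.map some id (w x))
      (Fin.snoc (α := fun _ => Option A ⊕ B) (fun x => Sum.map some id (w' x)) (Sum.inl none))).forall_generic
    refine (hM.and (hA.and hP)).congr fun P M _ _ f _ p _ m => ?_
    have e1 : ∀ (y : M) (o : A ⊕ B), Sum.map p (fun o => o.elim y m) (Sum.map id some o) = Sum.map p m o := by
      rintro y (a | b) <;> rfl
    have e2 : ∀ (x : P) (o : A ⊕ B), Sum.map (fun o => o.elim x p) m (Sum.map some id o) = Sum.map p m o := by
      rintro x (a | b) <;> rfl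
    have s1 : ∀ y : M, (fun x => Sum.map p (fun o => o.elim y m) (Fin.snoc (α := fun _ => A ⊕ Option B)
        (fun x => Sum.map id some (w' x)) (Sum.inr none) x)) =
        (Fin.snoc (α := fun _ => P ⊕ M) (fun x => Sum.map p m (w' x)) (Sum.inr y)) := by
      intro y
      funext j
      induction j using Fin.lastCases <;> simp; rfl
    have s2 : ∀ a : A, (fun x => Sum.map p m (Fin.snoc (α := fun _ => A ⊕ B) w' (Sum.inl a) x)) =
        (Fin.snoc (α := fun _ => P ⊕ M) (fun x => Sum.map p m (w' x)) (Sum.inl (p a))) := by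
      intro y
      funext j
      induction j using Fin.lastCases <;> simp
    have s3 : ∀ x : P, (fun o => Sum.map (fun o => o.elim x p) m (Fin.snoc (α := fun _ => Option A ⊕ B)
        (fun x => Sum.map some id (w' x)) (Sum.inl none) o)) =
        (Fin.snoc (α := fun _ => P ⊕ M) (fun x => Sum.map p m (w' x)) (Sum.inl x)) := by
      intro y
      funext j
      induction j using Fin.lastCases <;> simp; rfl
    simp only [e1, e2, s1, s2, s3]
    constructor
    · exact fun h => ⟨fun y => h (Sum.inr y), fun a => h (Sum.inl (p a)), fun x _ => h (Sum.inl x)⟩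
    · rintro ⟨h1, h2, h3⟩ (x | y)
      · by_cases hx : ∃ a, x = p a
        · obtain ⟨a, rfl⟩ := hx
          exact h2 a
        · push Not at hx
          exact h3 x hx
      · exact h1 y

end Elimination

/-! ### Completeness of the theory of rich structures -/

theorem genModel_model (T : L.Theory) {P M : Type u} [L.Structure M] [Nonempty M] [M ⊨ T]
    (f : I → (Fin k → P) → M) (hf : OnePointRich f) : GenModel L f ⊨ genTheory T I k := by
  rw [Theory.model_iff]
  intro φ hφ
  exact hφ (Theory.ModelType.of T M) P f hf.infinite hf.rich

/-- A sentence has no variables and, as `k ≥ 1`, there is no tuple from the empty set at which to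
evaluate a function; so elimination leaves an `L`-sentence, decided by `T`. For consistency, a rich
family is generated freely from the empty set. -/
theorem genTheory_isMaximal {T : L.Theory} (hT : T.IsMaximal) (hk : 1 ≤ k) : (genTheory T I k).IsMaximal := by
  have hex : ∃ (M : Theory.ModelType.{u, u, u} T) (P : Type u) (f : I → (Fin k → P) → M), OnePointRich f := by
    obtain ⟨M⟩ := hT.1
    obtain ⟨m⟩ := M.nonempty'
    obtain ⟨P, _, f, -, hf, -⟩ := exists_rich_extension (Q := PEmpty) (fun (_ : I) (_ : Fin k → PEmpty) => m)
    exact ⟨M, P, f, hf.onePointRich⟩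
  have key : ∀ φ : (genLang L I k).Sentence, ∃ ψ : L.Sentence,
      ∀ (P M : Type u) [L.Structure M] [Nonempty M] (f : I → (Fin k → P) → M), OnePointRich f →
        (GenModel L f ⊨ φ ↔ M ⊨ ψ) := by
    intro φ
    obtain ⟨J, θ, h⟩ := eliminable_realize φ (A := PEmpty) (B := PEmpty) Empty.elim Fin.elim0
    have : IsEmpty (Fin k → PEmpty.{u + 1}) := ⟨fun c => (c ⟨0, hk⟩).elim⟩
    refine ⟨θ.relabel (Sum.elim PEmpty.elim fun x => isEmptyElim x.2), fun P M _ _ f hf => ?_⟩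
    have := h P M f hf PEmpty.elim (fun a => a.elim) PEmpty.elim
    rw [Sentence.Realize, Sentence.Realize, Formula.realize_relabel]
    refine Iff.trans ?_ (this.trans ?_)
    · apply iff_of_eq
      rw [Formula.Realize]
      congr 1
      · funext x
        exact x.elim
      · funext x
        exact x.elim0
    · apply iff_of_eq
      congr 1
      funext x
      rcases x with x | x
      · exact x.elim
      · exact isEmptyElim x.2
  constructor
  · obtain ⟨M, P, f, hf⟩ := hex
    have := genModel_model T f hf
    exact Theory.Model.isSatisfiable (GenModel L f)
  · intro φ
    obtain ⟨ψ, hψ⟩ := key φ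
    have hmem : ∀ χ : (genLang L I k).Sentence, (∀ (M : Theory.ModelType.{u, u, u} T) (P : Type u)
        (f : I → (Fin k → P) → M), OnePointRich f → GenModel L f ⊨ χ) → χ ∈ genTheory T I k :=
      fun χ h M P f _ hf => h M P f hf.onePointRich
    rcases hT.2 ψ with h | h
    · refine Or.inl (hmem _ fun M P f hf => ?_)
      rw [hψ P M f hf]
      exact Theory.realize_sentence_of_mem T h
    · refine Or.inr (hmem _ fun M P f hf => ?_)
      rw [Sentence.realize_not, hψ P M f hf, ← Sentence.realize_not]
      exact Theory.realize_sentence_of_mem T h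

end Generic

section Expressible

variable {L : FirstOrder.Language.{u, u}} {I : Type u} {k : ℕ} {A B : Type u}

/-- The relation symbol of the one-sorted language given by `R`. -/
def GenRel.symbol {n : ℕ} (R : GenRel L I k n) : (genLang L I k).Relations n := R

/-! ### Conditions expressible in the one-sorted language -/

/-- The condition `Φ` is given by a first order formula of the one-sorted structures `(P, M, f)`. -/
def Expressible (Φ : GenPred L I k A B) : Prop :=
  ∃ ψ : (genLang L I k).Formula (A ⊕ B), ∀ (P M : Type u) [L.Structure M] (f : I → (Fin k → P) → M)
    (p : A → P) (m : B → M), @Formula.Realize _ _ (genStructure L f) _ ψ (Sum.map p m) ↔ Φ P M f p m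

variable {Φ Ψ : GenPred L I k A B}

theorem Expressible.congr (h : Expressible Φ)
    (h' : ∀ (P M : Type u) [L.Structure M] (f : I → (Fin k → P) → M) (p : A → P) (m : B → M),
      (Ψ P M f p m ↔ Φ P M f p m)) : Expressible Ψ := by
  obtain ⟨ψ, h⟩ := h
  exact ⟨ψ, fun P M _ f p m => (h P M f p m).trans (h' P M f p m).symm⟩

theorem Expressible.imp (h : Expressible Φ) (h' : Expressible Ψ) :
    Expressible ((fun P M _ f p m => Φ P M f p m → Ψ P M f p m) : GenPred L I k A B) := by
  obtain ⟨ψ, h⟩ := h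
  obtain ⟨ψ', h'⟩ := h'
  exact ⟨ψ.imp ψ', fun P M _ f p m => by
    let _ := genStructure L f
    rw [Formula.realize_imp, h, h']⟩

theorem Expressible.and (h : Expressible Φ) (h' : Expressible Ψ) :
    Expressible ((fun P M _ f p m => Φ P M f p m ∧ Ψ P M f p m) : GenPred L I k A B) := by
  obtain ⟨ψ, h⟩ := h
  obtain ⟨ψ', h'⟩ := h'
  exact ⟨ψ ⊓ ψ', fun P M _ f p m => by
    let _ := genStructure L f
    rw [Formula.realize_inf, h, h']⟩

theorem Expressible.not (h : Expressible Φ) :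
    Expressible ((fun P M _ f p m => ¬ Φ P M f p m) : GenPred L I k A B) := by
  obtain ⟨ψ, h⟩ := h
  exact ⟨ψ.not, fun P M _ f p m => by
    let _ := genStructure L f
    rw [Formula.realize_not, h]⟩

theorem expressible_const (q : Prop) :
    Expressible ((fun _ _ _ _ _ _ => q) : GenPred L I k A B) := by
  by_cases h : q
  · exact ⟨⊤, fun P M _ f p m => by
      let _ := genStructure L f
      simp [h]⟩
  · exact ⟨⊥, fun P M _ f p m => by
      let _ := genStructure L f
      simp [h]⟩

theorem Expressible.forall_finite {C : Type*} [Finite C] {Φ : C → GenPred L I k A B}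
    (h : ∀ c, Expressible (Φ c)) :
    Expressible ((fun P M _ f p m => ∀ c, Φ c P M f p m) : GenPred L I k A B) := by
  choose ψ h using h
  exact ⟨Formula.iInf ψ, fun P M _ f p m => by
    let _ := genStructure L f
    rw [Formula.realize_iInf]
    exact forall_congr' fun c => h c P M f p m⟩

theorem Expressible.exists_model {C : Type u} [Finite C] {Φ : GenPred L I k A (B ⊕ C)}
    (h : Expressible Φ) :
    Expressible ((fun P M _ f p m => ∃ y : C → M, Φ P M f p (Sum.elim m y)) : GenPred L I k A B) := by
  obtain ⟨ψ, h⟩ := h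
  refine ⟨Formula.iExs C ((Formula.iInf fun c => Relations.formula
      (GenRel.inM : GenRel L I k 1).symbol fun _ => Term.var (Sum.inr c)) ⊓
    ψ.relabel (Equiv.sumAssoc A B C).symm), fun P M _ f p m => ?_⟩
  let _ := genStructure L f
  rw [Formula.realize_iExs]
  have e : ∀ y : C → M, (fun a => Sum.elim (Sum.map p m) (fun c => Sum.inr (y c)) a) ∘ (Equiv.sumAssoc A B C).symm =
      Sum.map p (Sum.elim m y) := by
    intro y
    funext a
    rcases a with a | b | c <;> rfl
  constructor
  · rintro ⟨y, hy⟩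
    rw [Formula.realize_inf, Formula.realize_iInf] at hy
    obtain ⟨h1, h2⟩ := hy
    choose z hz using h1
    have hz' : y = fun c => Sum.inr (z c) := funext hz
    rw [Formula.realize_relabel, hz', e z, h] at h2
    exact ⟨z, h2⟩
  · rintro ⟨y, hy⟩
    refine ⟨fun c => Sum.inr (y c), ?_⟩
    rw [Formula.realize_inf, Formula.realize_iInf, Formula.realize_relabel, e y, h]
    exact ⟨fun c => ⟨y c, rfl⟩, hy⟩

theorem Expressible.exists_generic {Φ : GenPred L I k (Option A) B} (h : Expressible Φ) :
    Expressible ((fun P M _ f p m => ∃ x : P, Φ P M f (fun o => o.elim x p) m) : GenPred L I k A B) := by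
  obtain ⟨ψ, h⟩ := h
  refine ⟨Formula.iExs Unit ((Relations.formula
      (GenRel.inP : GenRel L I k 1).symbol fun _ => Term.var (Sum.inr ())) ⊓
    ψ.relabel (Sum.elim (fun o => o.elim (Sum.inr ()) fun a => Sum.inl (Sum.inl a))
      fun b => Sum.inl (Sum.inr b))), fun P M _ f p m => ?_⟩
  let _ := genStructure L f
  rw [Formula.realize_iExs]
  have e : ∀ x : P, (fun a => Sum.elim (Sum.map p m) (fun _ : Unit => Sum.inl x) a) ∘
      (Sum.elim (fun o : Option A => o.elim (Sum.inr ()) fun a => Sum.inl (Sum.inl a))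
      fun b => Sum.inl (Sum.inr b)) = Sum.map (fun o => o.elim x p) m := by
    intro y
    funext a
    rcases a with (_ | a) | b <;> rfl
  constructor
  · rintro ⟨y, hy⟩
    rw [Formula.realize_inf] at hy
    obtain ⟨⟨z, hz⟩, h2⟩ := hy
    have hz' : y = fun _ => Sum.inl z := funext fun _ => hz
    rw [Formula.realize_relabel, hz', e z, h] at h2
    exact ⟨z, h2⟩
  · rintro ⟨x, hx⟩
    refine ⟨fun _ => Sum.inl x, ?_⟩
    rw [Formula.realize_inf, Formula.realize_relabel, e x, h]
    exact ⟨⟨x, rfl⟩, hx⟩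

theorem expressible_eq_generic (a a' : A) :
    Expressible ((fun _ _ _ _ p _ => p a = p a') : GenPred L I k A B) :=
  ⟨Term.equal (Term.var (Sum.inl a)) (Term.var (Sum.inl a')), fun P M _ f p m => by
    let _ := genStructure L f
    rw [Formula.realize_equal]
    exact Sum.inl_injective.eq_iff⟩

theorem expressible_eq_model (b b' : B) :
    Expressible ((fun _ _ _ _ _ m => m b = m b') : GenPred L I k A B) :=
  ⟨Term.equal (Term.var (Sum.inr b)) (Term.var (Sum.inr b')), fun P M _ f p m => by
    let _ := genStructure L f
    rw [Formula.realize_equal]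
    exact Sum.inr_injective.eq_iff⟩

theorem expressible_fn (i : I) (c : Fin k → A) (b : B) :
    Expressible ((fun _ _ _ f p m => f i (fun l => p (c l)) = m b) : GenPred L I k A B) := by
  refine ⟨Relations.formula (GenRel.fn i : GenRel L I k (k + 1)).symbol
    (Fin.snoc (α := fun _ => (genLang L I k).Term (A ⊕ B)) (fun l => Term.var (Sum.inl (c l)))
      (Term.var (Sum.inr b))), fun P M _ f p m => ?_⟩
  let _ := genStructure L f
  rw [Formula.realize_rel]
  constructor
  · rintro ⟨x, h1, h2⟩
    simp only [Fin.snoc_castSucc, Fin.snoc_last, Term.realize_var, Sum.map_inl, Sum.map_inr,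
      Sum.inl.injEq, Sum.inr.injEq] at h1 h2
    simp only [h1, h2]
  · intro h
    exact ⟨fun l => p (c l), fun j => by simp, by simp [h]⟩

theorem expressible_graph {n : ℕ} (g : L.Functions n) (c : Fin n → B) (b : B) :
    Expressible ((fun _ _ _ _ _ m => Structure.funMap g (fun l => m (c l)) = m b) : GenPred L I k A B) := by
  refine ⟨Relations.formula (GenRel.graph g : GenRel L I k (n + 1)).symbol
    (Fin.snoc (α := fun _ => (genLang L I k).Term (A ⊕ B)) (fun l => Term.var (Sum.inr (c l)))
      (Term.var (Sum.inr b))), fun P M _ f p m => ?_⟩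
  let _ := genStructure L f
  rw [Formula.realize_rel]
  constructor
  · rintro ⟨x, h1, h2⟩
    simp only [Fin.snoc_castSucc, Fin.snoc_last, Term.realize_var, Sum.map_inr,
      Sum.inr.injEq] at h1 h2
    simp only [h1, h2]
  · intro h
    exact ⟨fun l => m (c l), fun j => by simp, by simp [h]⟩

theorem expressible_rel {n : ℕ} (R : L.Relations n) (c : Fin n → B) :
    Expressible ((fun _ _ _ _ _ m => Structure.RelMap R (fun l => m (c l))) : GenPred L I k A B) := by
  refine ⟨Relations.formula (GenRel.rel R : GenRel L I k n).symbol
    (fun l => Term.var (Sum.inr (c l))), fun P M _ f p m => ?_⟩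
  let _ := genStructure L f
  rw [Formula.realize_rel]
  constructor
  · rintro ⟨x, h1, h2⟩
    simp only [Term.realize_var, Sum.map_inr, Sum.inr.injEq] at h1
    simpa only [h1] using h2
  · intro h
    exact ⟨fun l => m (c l), fun j => by simp, h⟩

/-- The one-sorted language is relational, so the values of subterms are named by auxiliary elements
of `M` tied together by the graph relations. -/
theorem expressible_term {α : Type*} (t : L.Term α) : ∀ {B : Type u} (s : α → B) (b : B),
    Expressible ((fun _ _ _ _ _ m => t.realize (fun x => m (s x)) = m b) : GenPred L I k A B) := by
  induction t with
  | var x => exact fun s b => expressible_eq_model (s x) b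
  | @func n g ts ih =>
    intro B s b
    have h1 := Expressible.forall_finite fun j : Fin n =>
      ih j (B := B ⊕ ULift.{u} (Fin n)) (fun x => Sum.inl (s x)) (Sum.inr ⟨j⟩)
    have h2 := expressible_graph (I := I) (k := k) (A := A) (B := B ⊕ ULift.{u} (Fin n)) g
      (fun j => Sum.inr ⟨j⟩) (Sum.inl b)
    refine (h1.and h2).exists_model.congr fun P M _ f p m => ?_
    simp only [Term.realize_func, Sum.elim_inl, Sum.elim_inr]
    constructor
    · exact fun h => ⟨fun j => (ts j.down).realize fun x => m (s x), fun _ => rfl, h⟩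
    · rintro ⟨y, h1, h2⟩
      rw [← h2]
      simp only [h1]

theorem expressible_boundedFormula {α : Type*} {n : ℕ} (φ : L.BoundedFormula α n) :
    ∀ {B : Type u} (s : α → B) (s' : Fin n → B), Expressible
      ((fun _ _ _ _ _ m => φ.Realize (fun x => m (s x)) (fun x => m (s' x))) : GenPred L I k A B) := by
  induction φ with
  | falsum => exact fun s s' => expressible_const False
  | @equal n t₁ t₂ =>
    intro B s s'
    have h1 := expressible_term (I := I) (k := k) (A := A) (B := B ⊕ PUnit.{u + 1}) t₁
      (fun x => Sum.inl (Sum.elim s s' x)) (Sum.inr ⟨⟩)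
    have h2 := expressible_term (I := I) (k := k) (A := A) (B := B ⊕ PUnit.{u + 1}) t₂
      (fun x => Sum.inl (Sum.elim s s' x)) (Sum.inr ⟨⟩)
    refine (h1.and h2).exists_model.congr fun P M _ f p m => ?_
    have e : (fun x => m (Sum.elim s s' x)) = Sum.elim (fun x => m (s x)) (fun x => m (s' x)) := by
      funext x
      rcases x with x | x <;> rfl
    simp only [Sum.elim_inl, Sum.elim_inr, e]
    constructor
    · intro h
      exact ⟨fun _ => _, rfl, h.symm⟩
    · rintro ⟨y, h1, h2⟩
      exact h1.trans h2.symm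
  | @rel n l R ts =>
    intro B s s'
    have h1 := Expressible.forall_finite fun j : Fin l =>
      expressible_term (I := I) (k := k) (A := A) (B := B ⊕ ULift.{u} (Fin l)) (ts j)
      (fun x => Sum.inl (Sum.elim s s' x)) (Sum.inr ⟨j⟩)
    have h2 := expressible_rel (I := I) (k := k) (A := A) (B := B ⊕ ULift.{u} (Fin l)) R
      (fun j => Sum.inr ⟨j⟩)
    refine (h1.and h2).exists_model.congr fun P M _ f p m => ?_
    have e : (fun x => m (Sum.elim s s' x)) = Sum.elim (fun x => m (s x)) (fun x => m (s' x)) := by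
      funext x
      rcases x with x | x <;> rfl
    simp only [Sum.elim_inl, Sum.elim_inr, e]
    constructor
    · intro h
      exact ⟨fun j => (ts j.down).realize _, fun _ => rfl, h⟩
    · rintro ⟨y, h1, h2⟩
      simp only [← h1] at h2
      exact h2
  | imp _ _ h1 h2 => exact fun s s' => (h1 s s').imp (h2 s s')
  | @all n φ ih =>
    intro B s s'
    have h := (ih (B := B ⊕ PUnit.{u + 1}) (fun x => Sum.inl (s x))
      (Fin.snoc (α := fun _ => B ⊕ PUnit.{u + 1}) (fun x => Sum.inl (s' x)) (Sum.inr ⟨⟩)))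
    refine h.not.exists_model.not.congr fun P M _ f p m => ?_
    have e : ∀ y : PUnit.{u + 1} → M, (fun x => Sum.elim m y (Fin.snoc (α := fun _ => B ⊕ PUnit.{u + 1})
        (fun x => Sum.inl (s' x)) (Sum.inr ⟨⟩) x)) =
        Fin.snoc (α := fun _ => M) (fun x => m (s' x)) (y ⟨⟩) := by
      intro y
      funext j
      induction j using Fin.lastCases <;> simp
    simp only [Sum.elim_inl, e, not_exists, not_not]
    exact ⟨fun h y => h (y ⟨⟩), fun h y => h fun _ => y⟩

theorem expressible_formula (φ : L.Formula B) :
    Expressible ((fun _ _ _ _ _ m => φ.Realize m) : GenPred L I k A B) :=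
  (expressible_boundedFormula φ id Fin.elim0).congr fun P M _ f p m => by
    let _ := genStructure L f
    rw [Formula.Realize, iff_iff_eq]
    congr 1
    exact Subsingleton.elim _ _

/-- Conditions given by an `L`-formula applied to values of the functions are expressible. -/
theorem expressible_formula_values {C : Type u} [Finite C] (φ : L.Formula (B ⊕ C)) (i : C → I)
    (c : C → Fin k → A) : Expressible ((fun _ _ _ f p m =>
      φ.Realize (Sum.elim m fun x => f (i x) fun l => p (c x l))) : GenPred L I k A B) := by
  have h1 := Expressible.forall_finite fun x : C =>
    expressible_fn (L := L) (A := A) (B := B ⊕ C) (i x) (c x) (Sum.inr x)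
  refine (h1.and (expressible_formula φ)).exists_model.congr fun P M _ f p m => ?_
  simp only [Sum.elim_inr]
  constructor
  · exact fun h => ⟨_, fun _ => rfl, h⟩
  · rintro ⟨y, h1, h2⟩
    simp only [h1]
    exact h2

/-- For fixed `J` and `r` there are finitely many tuples `c`, and the prescribed values are
variables of sort `M`; hence one-point richness is a first-order scheme. -/
theorem expressible_onePoint (J : Finset I) (r : ℕ) :
    Expressible ((fun P _ _ f p m => Function.Injective p → ∃ x : P, (∀ c, x ≠ p c) ∧
      ∀ (i : J) (c : Fin k → Option (Fin r)), none ∈ Set.range c →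
        f i (fun l => (c l).elim x fun d => p ⟨d⟩) = m (i, ⟨c⟩)) :
      GenPred L I k (ULift.{u} (Fin r)) (J × ULift.{u} (Fin k → Option (Fin r)))) := by
  let A := ULift.{u} (Fin r)
  let B := J × ULift.{u} (Fin k → Option (Fin r))
  have h1 : Expressible ((fun _ _ _ _ p _ => Function.Injective p) : GenPred L I k A B) :=
    Expressible.forall_finite fun a => Expressible.forall_finite fun a' =>
      (expressible_eq_generic a a').imp (expressible_const (a = a'))
  have h2 : Expressible ((fun _ _ _ _ p _ => ∀ c : A, p none ≠ p (some c)) : GenPred L I k (Option A) B) :=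
    Expressible.forall_finite fun a => (expressible_eq_generic none (some a)).not
  have h3 : Expressible ((fun _ _ _ f p m => ∀ (i : J) (c : Fin k → Option (Fin r)), none ∈ Set.range c →
      f i (fun l => p ((c l).map ULift.up)) = m (i, ⟨c⟩)) : GenPred L I k (Option A) B) :=
    Expressible.forall_finite fun i => Expressible.forall_finite fun c =>
      (expressible_const _).imp (expressible_fn i.1 (fun l => (c l).map ULift.up) (i, ULift.up c))
  refine (h1.imp (h2.and h3).exists_generic).congr fun P M _ f p m => ?_
  have e : ∀ (x : P) (o : Option (Fin r)), (o.map ULift.up).elim x p = o.elim x fun d => p ⟨d⟩ := by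
    rintro x (_ | d) <;> rfl
  simp only [e]
  rfl

/-! ### All models of the theory of rich structures -/

/-- The universal closure of `ψ` holds in all rich structures, hence belongs to the theory. -/
theorem realize_of_model_genTheory {T : L.Theory} {N : Type u} [(genLang L I k).Structure N]
    (hN : N ⊨ genTheory T I k) {α : Type*} [Finite α] (ψ : (genLang L I k).Formula α)
    (h : ∀ (P M : Type u) [L.Structure M] [Nonempty M] (f : I → (Fin k → P) → M), M ⊨ T → Rich f →
      ∀ v : α → P ⊕ M, @Formula.Realize _ _ (genStructure L f) _ ψ v) (v : α → N) : ψ.Realize v := by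
  have h1 : Formula.iAlls α (ψ.relabel (Sum.inr : α → Empty ⊕ α)) ∈ genTheory T I k := by
    intro M P f _ hf
    let _ := genStructure L f
    rw [Sentence.Realize]
    rw [Formula.realize_iAlls]
    intro v
    rw [Formula.realize_relabel]
    exact h P M f inferInstance hf v
  have h2 := Theory.model_iff _ |>.1 hN _ h1
  rw [Sentence.Realize, Formula.realize_iAlls] at h2
  have h3 := h2 v
  rwa [Formula.realize_relabel] at h3

theorem Expressible.of_model_genTheory {T : L.Theory} [Finite A] [Finite B] (hΦ : Expressible Φ)
    (h : ∀ (P M : Type u) [L.Structure M] [Nonempty M] (f : I → (Fin k → P) → M), M ⊨ T → Rich f →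
      ∀ p m, Φ P M f p m) {P M : Type u} [L.Structure M] (f : I → (Fin k → P) → M)
    (hf : GenModel L f ⊨ genTheory T I k) (p : A → P) (m : B → M) : Φ P M f p m := by
  obtain ⟨ψ, hψ⟩ := hΦ
  let _ := genStructure L f
  have hf' : (P ⊕ M) ⊨ genTheory T I k := hf
  have key := realize_of_model_genTheory hf'
    (((Formula.iInf fun a : A => Relations.formula (GenRel.inP : GenRel L I k 1).symbol
      fun _ => Term.var (Sum.inl a)) ⊓ (Formula.iInf fun b : B => Relations.formula
      (GenRel.inM : GenRel L I k 1).symbol fun _ => Term.var (Sum.inr b))).imp ψ)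
    (by
      intro P M _ _ f hM hf v
      let _ := genStructure L f
      rw [Formula.realize_imp, Formula.realize_inf, Formula.realize_iInf, Formula.realize_iInf]
      rintro ⟨h1, h2⟩
      choose p hp using h1
      choose m hm using h2
      have : v = Sum.map p m := by
        funext x
        rcases x with a | b
        · exact hp a
        · exact hm b
      rw [this, hψ]
      exact h P M f hM hf p m) (Sum.map p m)
  rw [Formula.realize_imp, Formula.realize_inf, Formula.realize_iInf, Formula.realize_iInf, hψ] at key
  exact key ⟨fun a => ⟨p a, rfl⟩, fun b => ⟨m b, rfl⟩⟩

theorem model_of_genModel {T : L.Theory} {P M : Type u} [L.Structure M]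
    (f : I → (Fin k → P) → M) (hf : GenModel L f ⊨ genTheory T I k) : M ⊨ T := by
  rw [Theory.model_iff]
  intro φ hφ
  have e : ∀ (M : Type u) [L.Structure M] (m : PEmpty.{u + 1} → M),
      BoundedFormula.Realize φ (fun x => m (Empty.elim x)) (fun x => m (Fin.elim0 x)) ↔ M ⊨ φ := by
    intro M _ m
    rw [Sentence.Realize, Formula.Realize, Subsingleton.elim (fun x : Empty => m (Empty.elim x)) default,
      Subsingleton.elim (fun x : Fin 0 => m (Fin.elim0 x)) default]
  exact (e M PEmpty.elim).1 ((expressible_boundedFormula (I := I) (k := k) (A := PEmpty.{u + 1})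
    φ Empty.elim Fin.elim0).of_model_genTheory (T := T)
    (fun P M _ _ f hM _ _ m => (e M m).2 (Theory.realize_sentence_of_mem T hφ)) f hf PEmpty.elim PEmpty.elim)

theorem rich_of_genModel {T : L.Theory} {P M : Type u} [L.Structure M]
    (f : I → (Fin k → P) → M) (hf : GenModel L f ⊨ genTheory T I k) : OnePointRich f := by
  intro J r p hp z
  have h := (expressible_onePoint (L := L) (k := k) J r).of_model_genTheory (T := T) (by
      intro P M _ _ f hM hf p m hp
      obtain ⟨x, h1, h2⟩ := hf.onePointRich J r (fun d => p ⟨d⟩)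
        (fun a b hab => ULift.up_injective (hp hab)) (fun i c => m (i, ⟨c⟩))
      exact ⟨x, fun c => h1 c.down, h2⟩) f hf (fun d => p d.down) (fun y => z y.1 y.2.down)
      (fun a b hab => ULift.down_injective (hp hab))
  obtain ⟨x, h1, h2⟩ := h
  exact ⟨x, fun c => h1 ⟨c⟩, h2⟩

/-- In a model of the theory of rich structures, a relation that is in all rich structures the graph of
a function from tuples of sort `S` to the sort `M` is again of this kind. -/
theorem graph_of_model_genTheory {T : L.Theory} {N : Type u} [(genLang L I k).Structure N]
    (hN : N ⊨ genTheory T I k) {n : ℕ} (R : GenRel L I k (n + 1)) (S : GenRel L I k 1)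
    (h : ∀ (P M : Type u) [L.Structure M] (f : I → (Fin k → P) → M),
      (∀ v : Fin (n + 1) → GenModel L f, Structure.RelMap R.symbol v →
        (∀ j : Fin n, Structure.RelMap S.symbol fun _ => v j.castSucc) ∧
        Structure.RelMap (GenRel.inM : GenRel L I k 1).symbol fun _ => v (Fin.last n)) ∧
      ∀ v : Fin n → GenModel L f, (∀ j, Structure.RelMap S.symbol fun _ => v j) →
        ∃ y, ∀ x, Structure.RelMap R.symbol (Fin.snoc (α := fun _ => GenModel L f) v x) ↔ x = y) :
    (∀ v : Fin (n + 1) → N, Structure.RelMap R.symbol v →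
        (∀ j : Fin n, Structure.RelMap S.symbol fun _ => v j.castSucc) ∧
        Structure.RelMap (GenRel.inM : GenRel L I k 1).symbol fun _ => v (Fin.last n)) ∧
      ∀ v : Fin n → N, (∀ j, Structure.RelMap S.symbol fun _ => v j) →
        ∃ y, ∀ x, Structure.RelMap R.symbol (Fin.snoc (α := fun _ => N) v x) ↔ x = y := by
  let φ : (genLang L I k).Formula (Fin (n + 1)) := (R.symbol.formula Term.var).imp
    ((Formula.iInf fun j : Fin n => S.symbol.formula fun _ => Term.var j.castSucc) ⊓
      (GenRel.inM : GenRel L I k 1).symbol.formula fun _ => Term.var (Fin.last n))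
  have hφ : ∀ (N : Type u) [(genLang L I k).Structure N] (v : Fin (n + 1) → N), φ.Realize v ↔
      (Structure.RelMap R.symbol v → (∀ j : Fin n, Structure.RelMap S.symbol fun _ => v j.castSucc) ∧
        Structure.RelMap (GenRel.inM : GenRel L I k 1).symbol fun _ => v (Fin.last n)) := by
    intro N _ v
    simp only [φ, Formula.realize_imp, Formula.realize_inf, Formula.realize_iInf, Formula.realize_rel,
      Term.realize_var]
  let ψ : (genLang L I k).Formula (Fin n) :=
    (Formula.iInf fun j : Fin n => S.symbol.formula fun _ => Term.var j).imp
    (Formula.iExs Unit (Formula.iAlls Unit ((R.symbol.formula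
      (Fin.snoc (α := fun _ => (genLang L I k).Term ((Fin n ⊕ Unit) ⊕ Unit))
        (fun j => Term.var (Sum.inl (Sum.inl j))) (Term.var (Sum.inr ())))).iff
      (Term.equal (Term.var (Sum.inr ())) (Term.var (Sum.inl (Sum.inr ())))))))
  have hψ : ∀ (N : Type u) [(genLang L I k).Structure N] (v : Fin n → N), ψ.Realize v ↔
      ((∀ j, Structure.RelMap S.symbol fun _ => v j) →
        ∃ y, ∀ x, Structure.RelMap R.symbol (Fin.snoc (α := fun _ => N) v x) ↔ x = y) := by
    intro N _ v
    simp only [ψ, Formula.realize_imp, Formula.realize_iInf, Formula.realize_rel, Formula.realize_iExs,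
      Formula.realize_iAlls, Formula.realize_iff, Formula.realize_equal, Term.realize_var, Sum.elim_inr,
      Sum.elim_inl]
    have e : ∀ y x : Unit → N, (fun j => Term.realize (fun a => Sum.elim (fun a => Sum.elim v y a) x a)
        (Fin.snoc (α := fun _ => (genLang L I k).Term ((Fin n ⊕ Unit) ⊕ Unit))
        (fun j => Term.var (Sum.inl (Sum.inl j))) (Term.var (Sum.inr ())) j)) =
        Fin.snoc (α := fun _ => N) v (x ()) := by
      intro y x
      funext j
      induction j using Fin.lastCases <;> simp
    simp only [e]
    refine imp_congr_right fun _ => ?_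
    exact ⟨fun ⟨y, hy⟩ => ⟨y (), fun x => hy fun _ => x⟩, fun ⟨y, hy⟩ => ⟨fun _ => y, fun x => hy (x ())⟩⟩
  constructor
  · intro v
    rw [← hφ]
    refine realize_of_model_genTheory hN φ (fun P M _ _ f _ _ v => ?_) v
    exact (hφ (GenModel L f) v).2 ((h P M f).1 v)
  · intro v
    rw [← hψ]
    refine realize_of_model_genTheory hN ψ (fun P M _ _ f _ _ v => ?_) v
    exact (hψ (GenModel L f) v).2 ((h P M f).2 v)

/-- Every model of the theory of rich structures is of the form `(P, M, f)`. -/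
theorem exists_equiv_genModel {T : L.Theory} {N : Type u} [(genLang L I k).Structure N]
    (hN : N ⊨ genTheory T I k) : ∃ (P M : Type u) (_ : L.Structure M) (_ : Nonempty M)
      (f : I → (Fin k → P) → M), M ⊨ T ∧ OnePointRich f ∧ Nonempty (N ≃[genLang L I k] GenModel L f) := by
  classical
  let inP : N → Prop := fun x => Structure.RelMap (GenRel.inP : GenRel L I k 1).symbol fun _ => x
  let inM : N → Prop := fun x => Structure.RelMap (GenRel.inM : GenRel L I k 1).symbol fun _ => x
  have hsort : ∀ x, inP x ↔ ¬ inM x := by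
    let φ : (genLang L I k).Formula Unit :=
      ((GenRel.inP : GenRel L I k 1).symbol.formula fun _ => Term.var ()).iff
        ((GenRel.inM : GenRel L I k 1).symbol.formula fun _ => Term.var ()).not
    have hφ : ∀ (N : Type u) [(genLang L I k).Structure N] (v : Unit → N), φ.Realize v ↔
      (Structure.RelMap (GenRel.inP : GenRel L I k 1).symbol (fun _ => v ()) ↔
        ¬ Structure.RelMap (GenRel.inM : GenRel L I k 1).symbol (fun _ => v ())) := by
      intro N _ v
      simp only [φ, Formula.realize_iff, Formula.realize_not, Formula.realize_rel, Term.realize_var]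
    intro x
    refine (hφ N fun _ => x).1 (realize_of_model_genTheory hN φ (fun P M _ _ f _ _ v => ?_) _)
    refine (hφ (GenModel L f) v).2 ?_
    change (∃ p, v () = Sum.inl p) ↔ ¬ ∃ m, v () = Sum.inr m
    rcases v () with p | m <;> simp
  have hne : ∃ x, inM x := by
    let φ : (genLang L I k).Formula PEmpty.{1} :=
      Formula.iExs Unit ((GenRel.inM : GenRel L I k 1).symbol.formula fun _ => Term.var (Sum.inr ()))
    have hφ : ∀ (N : Type u) [(genLang L I k).Structure N] (v : PEmpty.{1} → N), φ.Realize v ↔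
      ∃ x : N, Structure.RelMap (GenRel.inM : GenRel L I k 1).symbol (fun _ => x) := by
      intro N _ v
      simp only [φ, Formula.realize_iExs, Formula.realize_rel, Term.realize_var, Sum.elim_inr]
      exact ⟨fun ⟨x, hx⟩ => ⟨x (), hx⟩, fun ⟨x, hx⟩ => ⟨fun _ => x, hx⟩⟩
    refine (hφ N PEmpty.elim).1 (realize_of_model_genTheory hN φ (fun P M _ _ f _ _ v => ?_) _)
    exact (hφ (GenModel L f) v).2 ⟨Sum.inr (Classical.arbitrary M), _, rfl⟩
  have hgraph := fun (n : ℕ) (g : L.Functions n) =>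
    graph_of_model_genTheory hN (GenRel.graph g) GenRel.inM (by
      intro P M _ f
      constructor
      · rintro v ⟨x, h1, h2⟩
        exact ⟨fun j => ⟨x j, h1 j⟩, ⟨_, h2⟩⟩
      · intro v hv
        choose m hm using hv
        refine ⟨Sum.inr (Structure.funMap g m), fun x => ?_⟩
        constructor
        · rintro ⟨x', h1, h2⟩
          simp only [Fin.snoc_castSucc, Fin.snoc_last] at h1 h2
          rw [h2]
          congr 2
          funext j
          exact Sum.inr_injective ((h1 j).symm.trans (hm j))
        · rintro rfl
          exact ⟨m, fun j => (Fin.snoc_castSucc ..).trans (hm j), Fin.snoc_last ..⟩)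
  have hfn := fun i : I =>
    graph_of_model_genTheory hN (GenRel.fn i) GenRel.inP (by
      intro P M _ f
      constructor
      · rintro v ⟨x, h1, h2⟩
        exact ⟨fun j => ⟨x j, h1 j⟩, ⟨_, h2⟩⟩
      · intro v hv
        choose p hp using hv
        refine ⟨Sum.inr (f i p), fun x => ?_⟩
        constructor
        · rintro ⟨x', h1, h2⟩
          simp only [Fin.snoc_castSucc, Fin.snoc_last] at h1 h2
          rw [h2]
          congr 2
          funext j
          exact Sum.inl_injective ((h1 j).symm.trans (hp j))
        · rintro rfl
          exact ⟨p, fun j => (Fin.snoc_castSucc ..).trans (hp j), Fin.snoc_last ..⟩)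
  have hrel : ∀ (n : ℕ) (R : L.Relations n) (v : Fin n → N),
      Structure.RelMap (GenRel.rel R : GenRel L I k n).symbol v → ∀ j, inM (v j) := by
    intro n R
    let φ : (genLang L I k).Formula (Fin n) := ((GenRel.rel R : GenRel L I k n).symbol.formula Term.var).imp
      (Formula.iInf fun j : Fin n => (GenRel.inM : GenRel L I k 1).symbol.formula fun _ => Term.var j)
    have hφ : ∀ (N : Type u) [(genLang L I k).Structure N] (v : Fin n → N), φ.Realize v ↔
        (Structure.RelMap (GenRel.rel R : GenRel L I k n).symbol v →
          ∀ j, Structure.RelMap (GenRel.inM : GenRel L I k 1).symbol fun _ => v j) := by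
      intro N _ v
      simp only [φ, Formula.realize_imp, Formula.realize_iInf, Formula.realize_rel, Term.realize_var]
    intro v
    refine (hφ N v).1 (realize_of_model_genTheory hN φ (fun P M _ _ f _ _ v => ?_) _)
    exact (hφ (GenModel L f) v).2 fun ⟨x, h1, _⟩ j => ⟨x j, h1 j⟩
  -- The functions of the sort `M` and the `f i` are recovered from relations that the theory makes
  -- graphs of functions on the appropriate sorts.
  choose G hG using fun n g => (hgraph n g).2
  choose F hF using fun i => (hfn i).2
  have hGM : ∀ n g v hv, inM (G n g v hv) := fun n g v hv => by
    simpa using ((hgraph n g).1 _ ((hG n g v hv _).2 rfl)).2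
  have hFM : ∀ i v hv, inM (F i v hv) := fun i v hv => by
    simpa using ((hfn i).1 _ ((hF i v hv _).2 rfl)).2
  let P := {x // inP x}
  let M := {x // inM x}
  let sM : L.Structure M :=
    { funMap := fun {n} g x => ⟨G n g (fun j => (x j).1) (fun j => (x j).2), hGM _ _ _ _⟩
      RelMap := fun {n} R x => Structure.RelMap (GenRel.rel R : GenRel L I k n).symbol fun j => (x j).1 }
  let f : I → (Fin k → P) → M := fun i p => ⟨F i (fun j => (p j).1) (fun j => (p j).2), hFM _ _ _⟩
  let e : P ⊕ M → N := Sum.elim Subtype.val Subtype.val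
  have he : Function.Bijective e := by
    constructor
    · rintro (⟨x, hx⟩ | ⟨x, hx⟩) (⟨y, hy⟩ | ⟨y, hy⟩) hxy <;> obtain rfl : x = y := hxy
      · rfl
      · exact absurd hy ((hsort x).1 hx)
      · exact absurd hx ((hsort x).1 hy)
      · rfl
    · intro x
      by_cases hx : inM x
      · exact ⟨Sum.inr ⟨x, hx⟩, rfl⟩
      · exact ⟨Sum.inl ⟨x, (hsort x).2 hx⟩, rfl⟩
  have heP : ∀ x, inP (e x) → ∃ p, x = Sum.inl p := by
    rintro (p | ⟨x, hx⟩) h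
    · exact ⟨p, rfl⟩
    · exact absurd hx ((hsort x).1 h)
  have heM : ∀ x, inM (e x) → ∃ p, x = Sum.inr p := by
    rintro (⟨x, hx⟩ | m) h
    · exact absurd h ((hsort x).1 hx)
    · exact ⟨m, rfl⟩
  let E : GenModel L f ≃[genLang L I k] N :=
    { Equiv.ofBijective e he with
      map_fun' := fun g => PEmpty.elim g
      map_rel' := by
        intro n R v
        change Structure.RelMap R (e ∘ v) ↔ _
        cases R with
        | inP =>
          have e1 : e ∘ v = fun _ => e (v 0) := funext fun j => by rw [Subsingleton.elim j 0]; rfl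
          rw [e1]
          refine ⟨heP _, ?_⟩
          rintro ⟨p, hp⟩
          rw [hp]
          exact p.2
        | inM =>
          have e1 : e ∘ v = fun _ => e (v 0) := funext fun j => by rw [Subsingleton.elim j 0]; rfl
          rw [e1]
          refine ⟨heM _, ?_⟩
          rintro ⟨p, hp⟩
          rw [hp]
          exact p.2
        | @graph n g =>
          constructor
          · intro h
            obtain ⟨h1, h2⟩ := (hgraph n g).1 _ h
            choose x hx using fun j => heM _ (h1 j)
            obtain ⟨y, hy⟩ := heM _ h2
            have e1 : e ∘ v = Fin.snoc (α := fun _ => N) (fun j => (x j).1) y.1 := by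
              funext j
              induction j using Fin.lastCases with
              | last => rw [Fin.snoc_last]; exact congrArg e hy
              | cast j => rw [Fin.snoc_castSucc]; exact congrArg e (hx j)
            rw [e1] at h
            have := (hG n g (fun j => (x j).1) (fun j => (x j).2) _).1 h
            exact ⟨x, hx, hy.trans (congrArg Sum.inr (Subtype.ext this))⟩
          · rintro ⟨x, h1, h2⟩
            have e1 : e ∘ v = Fin.snoc (α := fun _ => N) (fun j => (x j).1)
                (G n g (fun j => (x j).1) (fun j => (x j).2)) := by
              funext j
              induction j using Fin.lastCases with
              | last => rw [Fin.snoc_last]; exact congrArg e h2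
              | cast j => rw [Fin.snoc_castSucc]; exact congrArg e (h1 j)
            rw [e1]
            exact (hG n g _ _ _).2 rfl
        | @rel n R =>
          constructor
          · intro h
            choose x hx using fun j => heM _ (hrel n R _ h j)
            refine ⟨x, hx, ?_⟩
            have e1 : e ∘ v = fun j => (x j).1 := funext fun j => congrArg e (hx j)
            rw [e1] at h
            exact h
          · rintro ⟨x, h1, h2⟩
            have e1 : e ∘ v = fun j => (x j).1 := funext fun j => congrArg e (h1 j)
            rw [e1]
            exact h2
        | fn i =>
          constructor
          · intro h
            obtain ⟨h1, h2⟩ := (hfn i).1 _ h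
            choose x hx using fun j => heP _ (h1 j)
            obtain ⟨y, hy⟩ := heM _ h2
            have e1 : e ∘ v = Fin.snoc (α := fun _ => N) (fun j => (x j).1) y.1 := by
              funext j
              induction j using Fin.lastCases with
              | last => rw [Fin.snoc_last]; exact congrArg e hy
              | cast j => rw [Fin.snoc_castSucc]; exact congrArg e (hx j)
            rw [e1] at h
            have := (hF i (fun j => (x j).1) (fun j => (x j).2) _).1 h
            exact ⟨x, hx, hy.trans (congrArg Sum.inr (Subtype.ext this))⟩
          · rintro ⟨x, h1, h2⟩
            have e1 : e ∘ v = Fin.snoc (α := fun _ => N) (fun j => (x j).1)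
                (F i (fun j => (x j).1) (fun j => (x j).2)) := by
              funext j
              induction j using Fin.lastCases with
              | last => rw [Fin.snoc_last]; exact congrArg e h2
              | cast j => rw [Fin.snoc_castSucc]; exact congrArg e (h1 j)
            rw [e1]
            exact (hF i _ _ _).2 rfl }
  have hmod : GenModel L f ⊨ genTheory T I k :=
    (E.symm.toElementaryEmbedding.theory_model_iff _).1 hN
  obtain ⟨x, hx⟩ := hne
  exact ⟨P, M, sM, ⟨⟨x, hx⟩⟩, f, model_of_genModel f hmod, rich_of_genModel f hmod, ⟨E.symm⟩⟩

end Expressible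

/-! ### From `k`-trace definability to trace definability in rich structures -/

section QFDefinable

variable {L : FirstOrder.Language.{u, u}} {O N : Type u} [L.Structure N] {k n : ℕ}

theorem QFDefinable.mono {E E' : Set ((Fin k → O) → N)} (hE : E ⊆ E') {X : Set (Fin n → O)}
    (h : QFDefinable L E X) : QFDefinable L E' X := by
  induction h with
  | eq s t => exact QFDefinable.eq s t
  | rel d f hf t Y hY => exact QFDefinable.rel d f (fun j => hE (hf j)) t Y hY
  | compl X _ h => exact QFDefinable.compl X h
  | inter X X' _ _ h h' => exact QFDefinable.inter X X' h h'

/-- Only finitely many atoms occur in a Boolean combination; this is what makes the local notions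
manageable one set at a time. -/
theorem QFDefinable.exists_finite {E : Set ((Fin k → O) → N)} {X : Set (Fin n → O)}
    (h : QFDefinable L E X) : ∃ F ⊆ E, F.Finite ∧ QFDefinable L F X := by
  induction h with
  | eq s t => exact ⟨∅, Set.empty_subset _, Set.finite_empty, QFDefinable.eq s t⟩
  | rel d f hf t Y hY =>
    exact ⟨Set.range f, Set.range_subset_iff.2 hf, Set.finite_range f,
      QFDefinable.rel d f (fun j => Set.mem_range_self j) t Y hY⟩
  | compl X _ h =>
    obtain ⟨F, h1, h2, h3⟩ := h
    exact ⟨F, h1, h2, QFDefinable.compl X h3⟩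
  | inter X X' _ _ h h' =>
    obtain ⟨F, h1, h2, h3⟩ := h
    obtain ⟨F', h1', h2', h3'⟩ := h'
    exact ⟨F ∪ F', Set.union_subset h1 h1', h2.union h2', QFDefinable.inter X X'
      (h3.mono Set.subset_union_left) (h3'.mono Set.subset_union_right)⟩

end QFDefinable

section Forward

variable {L : FirstOrder.Language.{u, u}} {I O P M : Type u} [L.Structure M] {k : ℕ}

/-- Equality in `O` is read off the injective coordinate `s₀`; a definable relation between values
of functions in `E` is one between values of the `f i` at coordinates, hence first order in `(P, M,
f)`. -/
theorem QFDefinable.isTrace {f : I → (Fin k → P) → M} {s : Type u} (ι : s → O → P) (s₀ : s)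
    (hι : Function.Injective (ι s₀)) {E : Set ((Fin k → O) → M)}
    (hE : ∀ e ∈ E, ∃ i j, ∀ b, e b = f i fun l => ι j (b l)) {n : ℕ} {X : Set (Fin n → O)}
    (h : QFDefinable L E X) :
    IsTrace (genLang L I k) (N := GenModel L f) (fun o j => Sum.inl (ι j o)) X := by
  induction h with
  | eq t t' =>
    have h0 : IsTrace (genLang L I k) (N := GenModel L f) (fun o j => Sum.inl (ι j o))
        {a : Bool → O | a false = a true} := by
      refine ⟨_, definable_formula (Term.equal (Term.var (false, s₀)) (Term.var (true, s₀))), ?_⟩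
      ext a
      have e := Formula.realize_equal (L := genLang L I k) (M := GenModel L f)
        (t₁ := Term.var (false, s₀)) (t₂ := Term.var (true, s₀))
        (x := fun p : Bool × s => (Sum.inl (ι p.2 (a p.1)) : P ⊕ M))
      exact (Sum.inl_injective.comp hι).eq_iff.symm.trans e.symm
    exact h0.subst (fun b => if b then t' else t)
  | @rel d e he t Y hY =>
    obtain ⟨m, φ, t₁, rfl⟩ := exists_eq_realize hY
    choose i j hij using fun x => hE _ (he x)
    obtain ⟨ψ, hψ⟩ := expressible_formula_values (A := ULift.{u} (Fin d × Fin k) × s) (B := M)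
      (C := ULift.{u} (Fin d)) (φ.relabel fun x => Sum.elim (fun y => Sum.inr ⟨y⟩) Sum.inl (t₁ x))
      (fun x => i x.down) (fun x l => (⟨x.down, l⟩, j x.down))
    have h0 : IsTrace (genLang L I k) (N := GenModel L f) (fun o j => Sum.inl (ι j o))
        {a : Fin d × Fin k → O | (fun x => e x fun l => a (x, l)) ∈
          {y : Fin d → M | φ.Realize (Sum.elim y id ∘ t₁)}} := by
      refine ⟨_, definable_realize (M := GenModel L f) ψ (Sum.elim (fun x : ULift.{u} (Fin d × Fin k) × s => Sum.inl (x.1.down, x.2))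
        (fun b => Sum.inr (Sum.inr b))), ?_⟩
      ext a
      have h1 := hψ P M f (fun x => ι x.2 (a x.1.down)) id
      beta_reduce at h1
      rw [Formula.realize_relabel] at h1
      have e1 : (Sum.elim id fun x : ULift.{u} (Fin d) =>
          f (i x.down) fun l => ι (j x.down) (a (x.down, l))) ∘
          (fun x => Sum.elim (fun y => Sum.inr ⟨y⟩) Sum.inl (t₁ x)) =
          Sum.elim (fun x => e x fun l => a (x, l)) id ∘ t₁ := by
        funext x
        simp only [Function.comp]
        rcases t₁ x with y | b
        · exact (hij y _).symm
        · rfl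
      rw [e1] at h1
      refine h1.symm.trans (iff_of_eq ?_)
      change _ = Formula.Realize _ _
      congr 1
      funext x
      rcases x with x | x <;> rfl
    exact h0.subst (fun x : Fin d × Fin k => t x.1 x.2)
  | compl X _ h => exact h.compl
  | inter X X' _ _ h h' => exact h.inter h'

theorem strTraceDefines_genModel {L' : FirstOrder.Language.{u, u}} [L'.Structure O] {f : I → (Fin k → P) → M}
    {s : Type u} [Finite s] (ι : s → O → P) (s₀ : s) (hι : Function.Injective (ι s₀)) {E : Set ((Fin k → O) → M)}
    (hE : ∀ e ∈ E, ∃ i j, ∀ b, e b = f i fun l => ι j (b l)) (h : Witnesses L M L' O k E) :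
    StrTraceDefines (genLang L I k) (GenModel L f) L' O := by
  refine strTraceDefines_of_finite _ _ L' (fun o j => Sum.inl (ι j o)) ?_ ?_
  · intro a b hab
    exact hι (Sum.inl_injective (congrFun hab s₀))
  · intro m X hX
    exact (h m X hX).isTrace ι s₀ hι hE

/-- A family of functions `O^k → M` is coded by a single rich function. -/
theorem exists_rich_code (hk : 1 ≤ k) [Nonempty M] (C : Type u) (ev : C → (Fin k → O) → M) :
    ∃ (P : Type u) (ι : C → O → P) (f : PUnit.{u + 1} → (Fin k → P) → M), OnePointRich f ∧
      (∀ c, Function.Injective (ι c)) ∧ ∀ c b, ev c b = f ⟨⟩ fun l => ι c (b l) := by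
  obtain ⟨P, ι, f, hι, hf, -, h⟩ := exists_rich_extension (I := PUnit.{u + 1}) (Q := O × C)
    (fun _ (b : Fin k → O × C) => ev (b ⟨0, hk⟩).2 fun l => (b l).1)
  exact ⟨P, fun c o => ι (o, c), f, hf.onePointRich, fun c a b hab => congrArg Prod.fst (hι hab),
    fun c b => (h ⟨⟩ fun l => (b l, c)).symm⟩

variable {L' : FirstOrder.Language.{u, u}} {T : L.Theory} {T' : L'.Theory}

theorem KTraceDefines.traceDefines (hk : 1 ≤ k) (h : KTraceDefines T T' k) : TraceDefines (D T k) T' := by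
  obtain ⟨O, M, E, hE, h⟩ := h
  -- The extra index `none` provides an injective coordinate even when `E` is empty.
  obtain ⟨P, ι, f, hf, hι, hc⟩ := exists_rich_code hk (Option E) (fun c =>
    c.elim (fun _ => Classical.arbitrary M) fun e => e.1)
  have := genModel_model T f hf
  have := hE.to_subtype
  exact ⟨O, Theory.ModelType.of (D T k) (GenModel L f), strTraceDefines_genModel ι none (hι none)
    (fun e he => ⟨⟨⟩, some ⟨e, he⟩, hc (some ⟨e, he⟩)⟩) h⟩

theorem LocallyKTraceDefines.locallyTraceDefines (hk : 1 ≤ k) (h : LocallyKTraceDefines T T' k) :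
    LocallyTraceDefines (D T k) T' := by
  obtain ⟨O, M, E, h⟩ := h
  obtain ⟨P, ι, f, hf, hι, hc⟩ := exists_rich_code hk (Option E) (fun c =>
    c.elim (fun _ => Classical.arbitrary M) fun e => e.1)
  have := genModel_model T f hf
  refine ⟨O, Theory.ModelType.of (D T k) (GenModel L f), strLocallyTraceDefines_of_finite _ _ _ ?_⟩
  intro m X hX
  obtain ⟨F, hFE, hF, h⟩ := (h m X hX).exists_finite
  have := hF.to_subtype
  refine ⟨Option F, inferInstance, fun o j => Sum.inl (ι (j.map (Set.inclusion hFE)) o), ?_, ?_⟩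
  · intro a b hab
    exact hι none (Sum.inl_injective (congrFun hab none))
  · exact h.isTrace (f := f) (fun (j : Option F) => ι (j.map (Set.inclusion hFE))) none (hι none)
      (fun e he => ⟨⟨⟩, some ⟨e, he⟩, hc (some ⟨e, hFE he⟩)⟩)

theorem LocallyKTraceDefinesWith.traceDefines {κ : Cardinal.{u}} (h : LocallyKTraceDefinesWith T T' κ k) :
    TraceDefines (Dκ T κ k) T' := by
  classical
  obtain ⟨O, M, E, hE, h⟩ := h
  rw [← Cardinal.mk_out κ] at hE
  obtain ⟨g⟩ := hE
  -- Each member of `E` receives its own index, so no copies of `O` are needed; unused indices carry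
  -- a constant function.
  obtain ⟨P, ι, f, hι, hf, -, hc⟩ := exists_rich_extension (Q := O) (fun (i : κ.out) =>
    if hi : ∃ e, g e = i then hi.choose.1 else fun _ : Fin k → O => Classical.arbitrary M)
  have := genModel_model T f hf.onePointRich
  refine ⟨O, Theory.ModelType.of (Dκ T κ k) (GenModel L f), strTraceDefines_genModel (s := PUnit)
    (fun _ => ι) ⟨⟩ hι (fun e he => ⟨g ⟨e, he⟩, ⟨⟩, fun b => ?_⟩) h⟩
  have hi : ∃ e', g e' = g ⟨e, he⟩ := ⟨_, rfl⟩
  rw [hc, dif_pos hi, g.injective hi.choose_spec]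

end Forward

/-! ### From trace definability in rich structures to `k`-trace definability -/

section QFDefinable

variable {L : FirstOrder.Language.{u, u}} {O N : Type u} [L.Structure N] {k n : ℕ}
  {E : Set ((Fin k → O) → N)}

theorem qfDefinable_univ : QFDefinable L E (Set.univ : Set (Fin n → O)) := by
  convert! QFDefinable.rel (L := L) (E := E) (n := n) 0 Fin.elim0 (fun j => j.elim0) Fin.elim0 Set.univ
    Set.definable_univ

theorem qfDefinable_empty : QFDefinable L E (∅ : Set (Fin n → O)) := by
  simpa using (qfDefinable_univ (L := L) (E := E) (n := n)).compl

theorem QFDefinable.union {X Y : Set (Fin n → O)} (hX : QFDefinable L E X) (hY : QFDefinable L E Y) :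
    QFDefinable L E (X ∪ Y) := by
  simpa [Set.compl_inter] using (hX.compl.inter _ _ hY.compl).compl

theorem QFDefinable.iUnion {C : Type*} [Finite C] {X : C → Set (Fin n → O)}
    (h : ∀ c, QFDefinable L E (X c)) : QFDefinable L E (⋃ c, X c) := by
  have key : ∀ s : Set C, s.Finite → QFDefinable L E (⋃ c ∈ s, X c) := by
    intro s hs
    induction s, hs using Set.Finite.induction_on with
    | empty => simpa using qfDefinable_empty
    | insert _ _ ih =>
      rw [Set.biUnion_insert]
      exact (h _).union ih
  simpa using key Set.univ Set.finite_univ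

theorem QFDefinable.iInter {C : Type*} [Finite C] {X : C → Set (Fin n → O)}
    (h : ∀ c, QFDefinable L E (X c)) : QFDefinable L E (⋂ c, X c) := by
  have := (QFDefinable.iUnion fun c => (h c).compl).compl
  simpa [Set.compl_iUnion] using this

theorem qfDefinable_rel {D : Type*} [Finite D] {f : D → (Fin k → O) → N} (hf : ∀ j, f j ∈ E)
    (t : D → Fin k → Fin n ⊕ O) {Y : Set (D → N)} (hY : (Set.univ : Set N).Definable L Y) :
    QFDefinable L E {a : Fin n → O | (fun j => f j (fun l => termVal a (t j l))) ∈ Y} := by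
  obtain ⟨d, ⟨e⟩⟩ := Finite.exists_equiv_fin D
  convert! QFDefinable.rel (L := L) (E := E) (n := n) d (fun j => f (e.symm j)) (fun j => hf _)
    (fun j => t (e.symm j)) _ (definable_preimage_subst hY (fun j => Sum.inl (e j))) using 1
  ext a
  simp [Function.comp_def]

/-- A set that agrees on every cell of a finite quantifier-free definable partition with a
quantifier-free definable set is quantifier-free definable. -/
theorem QFDefinable.of_cells {C : Type*} [Finite C] {S : C → Set (Fin n → O)}
    (hS : ∀ c, QFDefinable L E (S c)) {X : Set (Fin n → O)}
    (h : ∀ a₀, ∃ Z, QFDefinable L E Z ∧ ∀ a, (∀ c, a ∈ S c ↔ a₀ ∈ S c) → (a ∈ X ↔ a ∈ Z)) :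
    QFDefinable L E X := by
  classical
  choose Z hZ hXZ using h
  let K : (C → Prop) → Set (Fin n → O) := fun ε => {a | ∀ c, a ∈ S c ↔ ε c}
  have hK : ∀ ε, QFDefinable L E (K ε) := by
    intro ε
    have : K ε = ⋂ c, if ε c then S c else (S c)ᶜ := by
      ext a
      simp only [K, Set.mem_ofPred_eq, Set.mem_iInter]
      refine forall_congr' fun c => ?_
      by_cases hc : ε c <;> simp [hc]
    rw [this]
    refine QFDefinable.iInter fun c => ?_
    by_cases hc : ε c
    · simpa [hc] using hS c
    · simpa [hc] using (hS c).compl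
  have : X = ⋃ ε : C → Prop, if hε : ∃ a₀, a₀ ∈ K ε then K ε ∩ Z hε.choose else ∅ := by
    ext a
    rw [Set.mem_iUnion]
    constructor
    · intro ha
      have hε : ∃ a₀, a₀ ∈ K (fun c => a ∈ S c) := ⟨a, fun c => Iff.rfl⟩
      refine ⟨fun c => a ∈ S c, ?_⟩
      rw [dif_pos hε]
      exact ⟨fun c => Iff.rfl, (hXZ _ a fun c => (hε.choose_spec c).symm).1 ha⟩
    · rintro ⟨ε, hε⟩
      by_cases h0 : ∃ a₀, a₀ ∈ K ε
      · rw [dif_pos h0] at hε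
        exact (hXZ _ a fun c => (hε.1 c).trans (h0.choose_spec c).symm).2 hε.2
      · rw [dif_neg h0] at hε
        exact hε.elim
  rw [this]
  refine QFDefinable.iUnion fun ε => ?_
  split_ifs with hε
  · exact (hK ε).inter _ _ (hZ _)
  · exact qfDefinable_empty

theorem qfDefinable_of_finite [Finite O] (X : Set (Fin n → O)) : QFDefinable L E X := by
  have : X = ⋃ a : X, ⋂ i, {b | termVal b (Sum.inl i) = termVal b (Sum.inr (a.1 i))} := by
    ext b
    simp only [termVal, Set.mem_iUnion, Set.mem_iInter, Set.mem_ofPred_eq, Sum.elim_inl, Sum.elim_inr, id]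
    exact ⟨fun hb => ⟨⟨b, hb⟩, fun _ => rfl⟩, fun ⟨a, ha⟩ => by rw [funext ha]; exact a.2⟩
  rw [this]
  exact QFDefinable.iUnion fun a => QFDefinable.iInter fun i => QFDefinable.eq _ _

end QFDefinable

section Backward

variable {L : FirstOrder.Language.{u, u}} {I P M : Type u} [L.Structure M] {k : ℕ}

/-- Equality on `P ⊕ M` can be expressed by functions with values in an elementary extension of `M`. -/
theorem exists_equality_coding (hk : 1 ≤ k) (hM : Infinite M ∨ (2 ≤ k ∧ Nontrivial M)) (P : Type u) :
    ∃ (N : Type u) (_ : L.Structure N) (_ : M ↪ₑ[L] N), ∀ (O : Type u) (s : Type) [Finite s]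
      (ρ : s → O → P ⊕ M), ∃ E : Set ((Fin k → O) → N), E.Finite ∧ ∀ (n : ℕ) (t t' : Fin n ⊕ O) (j j' : s),
        QFDefinable L E {a | ρ j (termVal a t) = ρ j' (termVal a t')} := by
  classical
  rcases hM with hM | ⟨hk2, hM⟩
  -- `N` is large enough for `P ⊕ M` to inject into it as a set, so equality can be tested on codes
  -- in `N`.
  · obtain ⟨N, ⟨emb⟩, hN⟩ := exists_elementaryEmbedding_card_eq_of_ge L M
      (max L.card (Cardinal.mk (P ⊕ M))) (by simp) (by
        simp only [Cardinal.lift_id, Cardinal.mk_sum]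
        exact le_max_of_le_right (self_le_add_left _ _))
    have hle : Cardinal.mk (P ⊕ M) ≤ Cardinal.mk N := hN ▸ le_max_right _ _
    obtain ⟨enc⟩ := hle
    refine ⟨N, inferInstance, emb, fun O s _ ρ => ⟨Set.range fun j b => enc (ρ j (b ⟨0, hk⟩)),
      Set.finite_range _, fun n t t' j j' => ?_⟩⟩
    convert! qfDefinable_rel (L := L) (D := Bool) (E := Set.range fun j b => enc (ρ j (b ⟨0, hk⟩)))
      (f := fun c => if c then (fun b => enc (ρ j' (b ⟨0, hk⟩))) else (fun b => enc (ρ j (b ⟨0, hk⟩))))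
      (by rintro (_ | _) <;> simp) (fun c _ => if c then t' else t)
      (definable_formula (Term.equal (Term.var false) (Term.var true))) using 1
    ext a
    simp only [Set.mem_ofPred_eq]
    rw [Formula.realize_equal]
    simp
  · obtain ⟨c, d, hcd⟩ := hM
    -- With two arguments available, the function can itself compare the coordinates and answer `c`
    -- or `d`.
    refine ⟨M, inferInstance, ElementaryEmbedding.refl L M, fun O s _ ρ =>
      ⟨Set.range fun (q : s × s) b => if ρ q.1 (b ⟨0, hk⟩) = ρ q.2 (b ⟨1, hk2⟩) then c else d,
      Set.finite_range _, fun n t t' j j' => ?_⟩⟩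
    convert! qfDefinable_rel (L := L) (D := Unit) (E := Set.range fun (q : s × s) b =>
      if ρ q.1 (b ⟨0, hk⟩) = ρ q.2 (b ⟨1, hk2⟩) then c else d)
      (f := fun _ b => if ρ j (b ⟨0, hk⟩) = ρ j' (b ⟨1, hk2⟩) then c else d)
      (fun _ => ⟨(j, j'), rfl⟩) (fun _ l => if l = ⟨0, hk⟩ then t else t')
      (definable_realize (Term.equal (Term.var false) (Term.var true))
        (fun b => if b then Sum.inr c else Sum.inl ())) using 1
    ext a
    simp only [Set.mem_ofPred_eq]
    rw [Formula.realize_equal]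
    simp [hcd.symm]

variable {N : Type u} [L.Structure N] {O : Type u} {s : Type} {f : I → (Fin k → P) → M}

open Classical in
/-- The values of the function with index `i` at the points of sort `P` given by `ρ`. -/
noncomputable def pullFn (f : I → (Fin k → P) → M) (emb : M → N) (c : N) (ρ : s → O → P ⊕ M)
    (i : I) (σ : Fin k → s) (b : Fin k → O) : N :=
  if h : ∀ l, ∃ p, ρ (σ l) (b l) = Sum.inl p then emb (f i fun l => (h l).choose) else c

theorem pullFn_eq (emb : M → N) (c : N) (ρ : s → O → P ⊕ M) (i : I) (σ : Fin k → s) (b : Fin k → O)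
    (p : Fin k → P) (h : ∀ l, ρ (σ l) (b l) = Sum.inl (p l)) :
    pullFn f emb c ρ i σ b = emb (f i p) := by
  have h' : ∀ l, ∃ p, ρ (σ l) (b l) = Sum.inl p := fun l => ⟨p l, h l⟩
  rw [pullFn, dif_pos h']
  congr 2
  funext l
  exact Sum.inl_injective ((h' l).choose_spec.symm.trans (h l))

/-- Partition `O^n` according to the sorts of the elements substituted into `ψ` and the equalities
among them. On each cell, elimination turns `ψ` into an `L`-formula about elements of `M` and values
of the `f i`, which are values of functions in `E`; elementarity of `emb` lets it be evaluated in
`N`. -/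
theorem qfDefinable_pull [Nonempty M] (hf : OnePointRich f) (hk : 1 ≤ k) (emb : M ↪ₑ[L] N) {c d : N} (hcd : c ≠ d)
    {E : Set ((Fin k → O) → N)} {ρ : s → O → P ⊕ M}
    (hval : ∀ j, (fun b : Fin k → O => (ρ j (b ⟨0, hk⟩)).elim (fun _ => c) emb) ∈ E)
    (hsort : ∀ j, (fun b : Fin k → O => (ρ j (b ⟨0, hk⟩)).elim (fun _ => c) fun _ => d) ∈ E)
    (hfn : ∀ i σ, pullFn f emb c ρ i σ ∈ E)
    (heq : ∀ (n : ℕ) (t t' : Fin n ⊕ O) (j j' : s),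
        QFDefinable L E {a | ρ j (termVal a t) = ρ j' (termVal a t')})
    {α : Type u} [Finite α] (ψ : (genLang L I k).Formula α) {n : ℕ} (t : α → Fin n ⊕ O) (σ : α → s) :
    QFDefinable L E {a | ψ.Realize (M := GenModel L f) fun v => ρ (σ v) (termVal a (t v))} := by
  classical
  let val : (Fin n → O) → α → P ⊕ M := fun a v => ρ (σ v) (termVal a (t v))
  let S : α ⊕ α × α → Set (Fin n → O) := Sum.elim (fun v => {a | ∃ p, val a v = Sum.inl p})
    (fun v => {a | val a v.1 = val a v.2})
  have hS : ∀ c, QFDefinable L E (S c) := by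
    rintro (v | ⟨v, v'⟩)
    · convert! qfDefinable_rel (L := L) (D := Unit) (E := E) (fun _ => hsort (σ v)) (fun _ _ => t v)
        (definable_realize (Term.equal (Term.var false) (Term.var true))
        (fun b => if b then Sum.inr c else Sum.inl ())) using 1
      ext a
      simp only [Set.mem_ofPred_eq, S, Sum.elim_inl]
      rw [Formula.realize_equal]
      simp only [val]
      rcases ρ (σ v) (termVal a (t v)) with p | m <;> simp [hcd.symm]
    · exact heq n _ _ _ _
  refine QFDefinable.of_cells hS fun a₀ => ?_
  let A := {p : P // ∃ v, val a₀ v = Sum.inl p}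
  let B := {v : α // ∃ m, val a₀ v = Sum.inr m}
  choose rep hrep using fun x : A => x.2
  have : Finite A := Finite.of_injective rep fun x y hxy =>
    Subtype.ext (Sum.inl_injective ((hrep x).symm.trans (hxy ▸ hrep y)))
  -- Variables equal to the same point of `P` at `a₀` are identified, since elimination needs
  -- distinct points; variables of sort `M` stay separate.
  have hw : ∀ v, ∃ o : A ⊕ B, (∀ x, o = Sum.inl x → val a₀ v = Sum.inl x.1) ∧ ∀ y, o = Sum.inr y → y.1 = v := by
    intro v
    rcases hv : val a₀ v with p | m
    · refine ⟨Sum.inl ⟨p, v, hv⟩, fun x hx => ?_, fun y hy => by cases hy⟩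
      rw [← Sum.inl_injective hx]
    · refine ⟨Sum.inr ⟨v, m, hv⟩, fun x hx => (by cases hx), fun y hy => ?_⟩
      rw [← Sum.inr_injective hy]
  choose w hw1 hw2 using hw
  obtain ⟨J, θ, hθ⟩ := eliminable_realize (L := L) (I := I) (k := k) ψ w Fin.elim0
  refine ⟨_, qfDefinable_rel (L := L) (D := B ⊕ J × (Fin k → A)) (E := E)
    (f := Sum.elim (fun v b => (ρ (σ v.1) (b ⟨0, hk⟩)).elim (fun _ => c) emb)
      fun x => pullFn f emb c ρ x.1 fun l => σ (rep (x.2 l)))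
    (by
      rintro (v | x)
      · exact hval _
      · exact hfn _ _)
    (Sum.elim (fun v _ => t v.1) fun x l => t (rep (x.2 l))) (definable_formula θ), ?_⟩
  intro a ha
  have h1 : ∀ v, (∃ p, val a v = Sum.inl p) ↔ ∃ p, val a₀ v = Sum.inl p := fun v => ha (Sum.inl v)
  have h2 : ∀ v v', val a v = val a v' ↔ val a₀ v = val a₀ v' := fun v v' => ha (Sum.inr (v, v'))
  have hp : ∀ x : A, ∃ p, val a (rep x) = Sum.inl p := fun x => (h1 _).2 ⟨_, hrep x⟩
  choose p hp using hp
  have hm : ∀ v : B, ∃ m, val a v.1 = Sum.inr m := by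
    rintro ⟨v, m, hv⟩
    rcases hav : val a v with q | m'
    · obtain ⟨q', hq'⟩ := (h1 v).1 ⟨q, hav⟩
      rw [hv] at hq'
      cases hq'
    · exact ⟨m', rfl⟩
  choose m hm using hm
  have hpinj : Function.Injective p := by
    intro x y hxy
    have h3 : val a (rep x) = val a (rep y) := by rw [hp, hp, hxy]
    rw [h2, hrep, hrep] at h3
    exact Subtype.ext (Sum.inl_injective h3)
  have hval' : ∀ v, val a v = Sum.map p m (w v) := by
    intro v
    rcases hv : w v with x | y
    · rw [Sum.map_inl, ← hp x, h2, hw1 v x hv, hrep]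
    · rw [Sum.map_inr, ← hm y, hw2 v y hv]
  have key := hθ P M f hf p hpinj m
  simp only [← hval'] at key
  have e1 : BoundedFormula.Realize (M := GenModel L f) ψ (val a) (fun x => Sum.map p m (Fin.elim0 x)) ↔
      ψ.Realize (M := GenModel L f) (val a) :=
    iff_of_eq (congrArg (fun xs : Fin 0 → GenModel L f =>
      BoundedFormula.Realize (M := GenModel L f) ψ (val a) xs)
      (Subsingleton.elim _ _))
  refine e1.symm.trans (key.trans ?_)
  rw [← emb.map_formula]
  apply iff_of_eq
  simp only [Set.mem_ofPred_eq]
  congr 1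
  funext x
  rcases x with v | x
  · simp only [Function.comp, Sum.elim_inl]
    change _ = (val a v.1).elim (fun _ => c) emb
    rw [hm v]
    rfl
  · simp only [Function.comp, Sum.elim_inr]
    exact (pullFn_eq _ _ _ _ _ _ _ fun l => hp (x.2 l)).symm

end Backward

section Backward

variable {L : FirstOrder.Language.{u, u}} {I P M : Type u} [L.Structure M] {k : ℕ}

/-- Pullbacks of definable sets of a rich structure along finitely many maps are quantifier-free
definable through functions with values in an elementary extension `N` of `M`. -/
theorem exists_qfDefinable_pull [Nonempty M] {f : I → (Fin k → P) → M} (hf : OnePointRich f) (hk : 1 ≤ k)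
    (hM : Infinite M ∨ (2 ≤ k ∧ Nontrivial M)) :
    ∃ (N : Type u) (_ : L.Structure N) (_ : M ↪ₑ[L] N), ∀ (O : Type u) (s : Type) [Finite s]
      (ρ : s → O → P ⊕ M), ∃ (F : Set ((Fin k → O) → N)) (G : I × (Fin k → s) → (Fin k → O) → N), F.Finite ∧
        ∀ (α : Type u) [Finite α] (ψ : (genLang L I k).Formula α) (n : ℕ) (t : α → Fin n ⊕ O) (σ : α → s),
          QFDefinable L (F ∪ Set.range G)
            {a | ψ.Realize (M := GenModel L f) fun v => ρ (σ v) (termVal a (t v))} := by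
  obtain ⟨N, sN, emb, hN⟩ := exists_equality_coding (L := L) hk hM P
  have hM' : Nontrivial M := by
    rcases hM with hM | hM
    · infer_instance
    · exact hM.2
  obtain ⟨x, y, hxy⟩ := hM'
  refine ⟨N, sN, emb, fun O s _ ρ => ?_⟩
  obtain ⟨F, hF, heq⟩ := hN O s ρ
  let F₁ : Set ((Fin k → O) → N) := Set.range fun j b => (ρ j (b ⟨0, hk⟩)).elim (fun _ => emb x) emb
  let F₂ : Set ((Fin k → O) → N) :=
    Set.range fun j b => (ρ j (b ⟨0, hk⟩)).elim (fun _ => emb x) fun _ => emb y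
  refine ⟨F ∪ (F₁ ∪ F₂), fun q => pullFn f emb (emb x) ρ q.1 q.2,
    hF.union ((Set.finite_range _).union (Set.finite_range _)), fun α _ ψ n t σ => ?_⟩
  refine qfDefinable_pull hf hk emb (fun h => hxy (emb.injective h)) (fun j => ?_) (fun j => ?_)
    (fun i σ => Or.inr ⟨(i, σ), rfl⟩) (fun n t t' j j' => (heq n t t' j j').mono fun e he => ?_) ψ t σ
  · exact Or.inl (Or.inr (Or.inl ⟨j, rfl⟩))
  · exact Or.inl (Or.inr (Or.inr ⟨j, rfl⟩))
  · exact Or.inl (Or.inl he)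

variable {L' : FirstOrder.Language.{u, u}} {T : L.Theory} {T' : L'.Theory}

/-- Each parameter-free `L'`-formula has a trace using finitely many parameters of `(P, M, f)`. If
`O` has at least as many elements as there are formulas, one function `η` on `O` takes all these
parameters as values. Adjoined to `τ` as a further coordinate, it replaces them by parameters from
`O`, while the number of coordinates stays finite. -/
theorem exists_witnesses_of_strTraceDefines [Nonempty M] {f : I → (Fin k → P) → M} (hf : OnePointRich f)
    (hk : 1 ≤ k) (hM : Infinite M ∨ (2 ≤ k ∧ Nontrivial M)) {O : Type u} [L'.Structure O] [Infinite O]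
    (hO : Cardinal.mk (Σ m : ℕ, L'.Formula (Fin m)) ≤ Cardinal.mk O)
    (h : StrTraceDefines (genLang L I k) (GenModel L f) L' O) :
    ∃ (N : Type u) (_ : L.Structure N) (_ : M ↪ₑ[L] N) (s : Type) (_ : Finite s)
      (F : Set ((Fin k → O) → N)) (G : I × (Fin k → s) → (Fin k → O) → N), F.Finite ∧
        Witnesses L N L' O k (F ∪ Set.range G) := by
  classical
  obtain ⟨r, τ, hτ, h⟩ := h
  have h' : ∀ φ : Σ m : ℕ, L'.Formula (Fin m), ∃ (d : ℕ) (ψ : (genLang L I k).Formula (Fin d))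
      (t : Fin d → (Fin φ.1 × Fin r) ⊕ GenModel L f), {a | φ.2.Realize a} =
        {a | ψ.Realize (Sum.elim (fun p : Fin φ.1 × Fin r => τ (a p.1) p.2) id ∘ t)} := by
    intro φ
    obtain ⟨Y, hY, e⟩ := h φ.1 {a | φ.2.Realize a} (definable_formula φ.2)
    obtain ⟨d, ψ, t, rfl⟩ := exists_eq_realize hY
    exact ⟨d, ψ, t, e⟩
  choose d ψ t e using h'
  have hcard : Cardinal.mk (Σ φ : Σ m : ℕ, L'.Formula (Fin m), Fin (d φ)) ≤ Cardinal.mk O := by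
    have h1 : Cardinal.mk (Σ φ : Σ m : ℕ, L'.Formula (Fin m), Fin (d φ)) ≤
        Cardinal.mk (O × ℕ) := by
      obtain ⟨g⟩ := hO
      exact ⟨⟨fun x => (g x.1, x.2.1), by
        rintro ⟨φ, i⟩ ⟨φ', i'⟩ hx
        obtain rfl := g.injective (congrArg Prod.fst hx)
        have := Fin.ext (congrArg Prod.snd hx)
        subst this
        rfl⟩⟩
    refine h1.trans ?_
    simp
  obtain ⟨g⟩ := hcard
  let η : O → P ⊕ M := fun o =>
    if ho : ∃ x c, g x = o ∧ t x.1 x.2 = Sum.inr c then ho.choose_spec.choose else Sum.inr (Classical.arbitrary M)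
  have hη : ∀ φ i c, t φ i = Sum.inr c → η (g ⟨φ, i⟩) = c := by
    intro φ i c hc
    have ho : ∃ x c, g x = g ⟨φ, i⟩ ∧ t x.1 x.2 = Sum.inr c := ⟨⟨φ, i⟩, c, rfl, hc⟩
    have e1 : η (g ⟨φ, i⟩) = ho.choose_spec.choose := dif_pos ho
    obtain ⟨h1, h2⟩ := ho.choose_spec.choose_spec
    have key : ∀ x c', g x = g ⟨φ, i⟩ → t x.1 x.2 = Sum.inr c' → c' = c := by
      intro x c' hx hc'
      obtain rfl := g.injective hx
      exact Sum.inr_injective (hc'.symm.trans hc)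
    exact e1.trans (key _ _ h1 h2)
  obtain ⟨N, sN, emb, hN⟩ := exists_qfDefinable_pull (L := L) hf hk hM
  obtain ⟨F, G, hF, hFG⟩ := hN O (Option (Fin r)) (fun j o => j.elim (η o) (τ o))
  refine ⟨N, sN, emb, Option (Fin r), inferInstance, F, G, hF, fun n X hX => ?_⟩
  obtain ⟨m, φ, t', rfl⟩ := exists_eq_realize hX
  let φ' : Σ m : ℕ, L'.Formula (Fin m) := ⟨m, φ⟩
  convert! hFG (ULift.{u} (Fin (d φ'))) ((ψ φ').relabel ULift.up) n
    (fun i => Sum.elim (fun x => t' x.1) (fun _ => Sum.inr (g ⟨φ', i.down⟩)) (t φ' i.down))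
    (fun i => Sum.elim (fun x => some x.2) (fun _ => none) (t φ' i.down)) using 1
  ext a
  simp only [Set.mem_ofPred_eq]
  have h1 := Set.ext_iff.1 (e φ') (Sum.elim a id ∘ t')
  refine h1.trans (Iff.trans (iff_of_eq ?_) (Formula.realize_relabel (M := GenModel L f)).symm)
  change Formula.Realize _ _ = _
  congr 1
  funext i
  simp only [Function.comp]
  rcases hi : t φ' i with x | c
  · rfl
  · exact (hη _ _ _ hi).symm

theorem exists_model_witnesses_of_traceDefines (hk : 1 ≤ k)
    (hT : ∀ M : Theory.ModelType.{u, u, u} T, Infinite M ∨ (2 ≤ k ∧ Nontrivial M)) (hTne : T.IsSatisfiable)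
    (hT' : T'.IsMaximal) (h : TraceDefines (genTheory T I k) T') :
    ∃ (O : Theory.ModelType.{u, u, u} T') (N : Theory.ModelType.{u, u, u} T) (s : Type) (_ : Finite s)
      (F : Set ((Fin k → O) → N)) (G : I × (Fin k → s) → (Fin k → O) → N), F.Finite ∧
        Witnesses L N L' O k (F ∪ Set.range G) := by
  obtain ⟨O₀, N₀, h₀⟩ := id h
  rcases finite_or_infinite O₀ with hO | hO
  · obtain ⟨N⟩ := hTne
    -- On a finite model every set is a finite union of points, each given by equations with
    -- parameters.
    exact ⟨O₀, N, Unit, inferInstance, ∅, fun _ _ => Classical.arbitrary N, Set.finite_empty,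
      fun n X _ => qfDefinable_of_finite X⟩
  -- The model is enlarged to make room for the parameters; completeness of `T'` ensures that the
  -- larger model is still trace definable.
  · obtain ⟨O, ⟨emb⟩, hO'⟩ := exists_elementaryEmbedding_card_eq_of_ge L' O₀
      (max (max L'.card (Cardinal.mk (Σ m : ℕ, L'.Formula (Fin m)))) (Cardinal.mk O₀)) (by simp) (by simp)
    have : O ⊨ T' := (emb.theory_model_iff T').1 inferInstance
    have : Infinite O := Infinite.of_injective emb emb.injective
    obtain ⟨N, hN⟩ := h.exists_model hT' (Theory.ModelType.of T' O)
    obtain ⟨P, M, sM, hM, f, hMT, hf, ⟨e⟩⟩ := exists_equiv_genModel N.is_model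
    obtain ⟨N', sN', emb', s, hs, F, G, hF, hFG⟩ := exists_witnesses_of_strTraceDefines hf hk
      (hT (Theory.ModelType.of T M)) (O := O) (by
        rw [hO']
        exact (le_max_right _ _).trans (le_max_left _ _)) (hN.elementary e.toElementaryEmbedding)
    have : N' ⊨ T := (emb'.theory_model_iff T).1 inferInstance
    have : Nonempty N' := hM.map emb'
    exact ⟨Theory.ModelType.of T' O, Theory.ModelType.of T N', s, hs, F, G, hF, hFG⟩

theorem TraceDefines.kTraceDefines (hk : 1 ≤ k)
    (hT : ∀ M : Theory.ModelType.{u, u, u} T, Infinite M ∨ (2 ≤ k ∧ Nontrivial M)) (hTne : T.IsSatisfiable)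
    (hT' : T'.IsMaximal) (h : TraceDefines (D T k) T') : KTraceDefines T T' k := by
  obtain ⟨O, N, s, _, F, G, hF, hFG⟩ := exists_model_witnesses_of_traceDefines hk hT hTne hT' h
  exact ⟨O, N, _, hF.union (Set.finite_range G), hFG⟩

theorem mk_range_prod_le {κ : Cardinal.{u}} (hκ : Cardinal.aleph0 ≤ κ) {I X : Type u} {s : Type} [Finite s]
    (hI : Cardinal.mk I ≤ κ) (G : I × s → X) : Cardinal.mk (Set.range G) ≤ κ := by
  refine Cardinal.mk_range_le.trans ?_
  rw [Cardinal.mk_prod, Cardinal.lift_uzero]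
  refine Cardinal.mul_le_of_le hκ hI ?_
  exact (Cardinal.lift_lt_aleph0.2 (Cardinal.lt_aleph0_of_finite s)).le.trans hκ

theorem TraceDefines.locallyKTraceDefinesWith {κ : Cardinal.{u}} (hκ : Cardinal.aleph0 ≤ κ) (hk : 1 ≤ k)
    (hT : ∀ M : Theory.ModelType.{u, u, u} T, Infinite M ∨ (2 ≤ k ∧ Nontrivial M)) (hTne : T.IsSatisfiable)
    (hT' : T'.IsMaximal) (h : TraceDefines (Dκ T κ k) T') : LocallyKTraceDefinesWith T T' κ k := by
  obtain ⟨O, N, s, _, F, G, hF, hFG⟩ := exists_model_witnesses_of_traceDefines hk hT hTne hT' h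
  refine ⟨O, N, _, ?_, hFG⟩
  refine (Cardinal.mk_union_le _ _).trans (Cardinal.add_le_of_le hκ ?_ ?_)
  · have := hF.to_subtype
    exact (Cardinal.lt_aleph0_of_finite F).le.trans hκ
  · exact mk_range_prod_le hκ (Cardinal.mk_out κ).le G

/-- All functions are allowed as witnesses and each set is handled separately: its finitely many
parameters become constant coordinates, so the model of `T'` need not be enlarged. The extension `N`
is chosen before the set, so it serves all of them. -/
theorem LocallyTraceDefines.locallyKTraceDefines (hk : 1 ≤ k)
    (hT : ∀ M : Theory.ModelType.{u, u, u} T, Infinite M ∨ (2 ≤ k ∧ Nontrivial M))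
    (h : LocallyTraceDefines (D T k) T') : LocallyKTraceDefines T T' k := by
  obtain ⟨O, N₀, h⟩ := h
  obtain ⟨P, M, sM, hM, f, hMT, hf, ⟨e⟩⟩ := exists_equiv_genModel N₀.is_model
  replace h := h.elementary e.toElementaryEmbedding
  obtain ⟨N, sN, emb, hN⟩ := exists_qfDefinable_pull (L := L) hf hk (hT (Theory.ModelType.of T M))
  have : N ⊨ T := (emb.theory_model_iff T).1 inferInstance
  have : Nonempty N := hM.map emb
  refine ⟨O, Theory.ModelType.of T N, Set.univ, fun n X hX => ?_⟩
  obtain ⟨r, τ, hτ, Y, hY, rfl⟩ := h n X hX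
  obtain ⟨d, ψ, t, rfl⟩ := exists_eq_realize hY
  obtain ⟨F, G, hF, hFG⟩ := hN O (Fin r ⊕ Fin d) (fun j o => Sum.elim (τ o)
    (fun i => Sum.elim (fun _ => Sum.inr (Classical.arbitrary M)) id (t i)) j)
  refine QFDefinable.mono (E := F ∪ Set.range G) (Set.subset_univ _) ?_
  convert! hFG (ULift.{u} (Fin d)) (ψ.relabel ULift.up) n
    (fun i => Sum.elim (fun x => Sum.inl x.1) (fun _ => Sum.inr (Classical.arbitrary O)) (t i.down))
    (fun i => Sum.elim (fun x => Sum.inl x.2) (fun _ => Sum.inr i.down) (t i.down)) using 1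
  ext a
  simp only [Set.mem_ofPred_eq]
  refine Iff.trans (iff_of_eq ?_) (Formula.realize_relabel (M := GenModel L f)).symm
  congr 1
  funext i
  simp only [Function.comp]
  rcases hi : t i with x | c
  · rfl
  · exact (congrArg (Sum.elim (fun _ => Sum.inr (Classical.arbitrary M)) id) hi).symm

end Backward

/-! ### Cardinalities -/

section Cardinality

variable {L : FirstOrder.Language.{u, u}} {κ : Cardinal.{u}}

theorem alls_injective {α : Type*} : ∀ n : ℕ,
    Function.Injective (BoundedFormula.alls : L.BoundedFormula α n → L.Formula α)
  | 0 => fun _ _ h => h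
  | n + 1 => fun φ ψ h => by
    have h' : φ.all = ψ.all := alls_injective n h
    injection h'

/-- A complete theory contains each sentence or its negation, so there are at most twice as many
sentences as elements of `T`. -/
theorem mk_sentence_le (hκ : Cardinal.aleph0 ≤ κ) {T : L.Theory} (hT : T.IsMaximal)
    (h : Cardinal.mk T ≤ κ) : Cardinal.mk L.Sentence ≤ κ := by
  have h1 : Cardinal.mk L.Sentence ≤ Cardinal.mk (T ⊕ T) := by
    have hn (φ : L.Sentence) (hφ : φ ∉ T) : φ.not ∈ T := (hT.mem_or_not_mem φ).resolve_left hφ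
    classical
    refine ⟨⟨fun φ => if hφ : φ ∈ T then Sum.inl ⟨φ, hφ⟩ else Sum.inr ⟨φ.not, hn φ hφ⟩, ?_⟩⟩
    intro φ ψ hφψ
    by_cases hφ : φ ∈ T <;> by_cases hψ : ψ ∈ T
    · simpa [hφ, hψ] using hφψ
    · simp [hφ, hψ] at hφψ
    · simp [hφ, hψ] at hφψ
    · have h2 : φ.not = ψ.not := by simpa [hφ, hψ] using hφψ
      injection h2
  refine h1.trans ?_
  rw [Cardinal.mk_sum, Cardinal.lift_id]
  exact Cardinal.add_le_of_le hκ h h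

theorem mk_sigma_nat_le (hκ : Cardinal.aleph0 ≤ κ) {F : ℕ → Type u} (h : ∀ n, Cardinal.mk (F n) ≤ κ) :
    Cardinal.mk (Σ n, F n) ≤ κ := by
  rw [Cardinal.mk_sigma]
  refine (Cardinal.sum_le_sum _ (fun _ => κ) h).trans ?_
  rw [Cardinal.sum_const, Cardinal.mk_nat, Cardinal.lift_aleph0, Cardinal.lift_uzero]
  exact Cardinal.mul_le_of_le hκ hκ le_rfl

/-- Distinct symbols of the same arity occur in distinct sentences, so the number of sentences
bounds the number of symbols. -/
theorem card_le_of_isMaximal (hκ : Cardinal.aleph0 ≤ κ) {T : L.Theory} (hT : T.IsMaximal)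
    (h : Cardinal.mk T ≤ κ) : L.card ≤ κ := by
  have hs := mk_sentence_le hκ hT h
  rw [Language.card, Cardinal.mk_sum, Cardinal.lift_id, Cardinal.lift_id]
  refine Cardinal.add_le_of_le hκ (mk_sigma_nat_le hκ fun n => ?_) (mk_sigma_nat_le hκ fun n => ?_)
  · refine le_trans (Cardinal.mk_le_of_injective (f := fun g => (BoundedFormula.alls
      ((Term.func g fun i => Term.var (Sum.inr i)).bdEqual (Term.func g fun i => Term.var (Sum.inr i))) :
      L.Sentence)) fun g g' hg => ?_) hs
    have h1 := alls_injective n hg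
    injection h1 with _ h2
    injection h2
  · refine le_trans (Cardinal.mk_le_of_injective (f := fun R => (BoundedFormula.alls
      (R.boundedFormula fun i => Term.var (Sum.inr i)) : L.Sentence)) fun R R' hR => ?_) hs
    have h1 := alls_injective n hR
    injection h1

theorem mk_formula_le (hκ : Cardinal.aleph0 ≤ κ) (h : L.card ≤ κ) (α : Type) [Finite α] :
    Cardinal.mk (L.Formula α) ≤ κ := by
  refine (Cardinal.mk_le_of_injective (f := fun φ : L.Formula α => (⟨0, φ⟩ : Σ n, L.BoundedFormula α n))
    fun _ _ h => by simpa using h).trans (BoundedFormula.card_le.trans (max_le hκ ?_))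
  rw [Cardinal.lift_uzero]
  exact Cardinal.add_le_of_le hκ ((Cardinal.lift_lt_aleph0.2 (Cardinal.lt_aleph0_of_finite α)).le.trans hκ) h

theorem card_genLang_le (hκ : Cardinal.aleph0 ≤ κ) (h : L.card ≤ κ) {I : Type u} (hI : Cardinal.mk I ≤ κ)
    (k : ℕ) : (genLang L I k).card ≤ κ := by
  let c : (genLang L I k).Symbols → Bool ⊕ L.Symbols ⊕ I := fun
    | .inl x => PEmpty.elim x.2
    | .inr ⟨_, .inP⟩ => .inl true
    | .inr ⟨_, .inM⟩ => .inl false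
    | .inr ⟨_, .graph g⟩ => .inr (.inl (.inl ⟨_, g⟩))
    | .inr ⟨_, .rel R⟩ => .inr (.inl (.inr ⟨_, R⟩))
    | .inr ⟨_, .fn i⟩ => .inr (.inr i)
  have hc : Function.Injective c := by
    rintro (⟨_, ⟨⟩⟩ | ⟨n, r⟩) (⟨_, ⟨⟩⟩ | ⟨n', r'⟩) hr
    cases r <;> cases r' <;> simp [c] at hr ⊢
    · obtain ⟨rfl, h⟩ := hr
      rw [eq_of_heq h]
    · obtain ⟨rfl, h⟩ := hr
      rw [eq_of_heq h]
    · rw [hr]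
  refine (Cardinal.mk_le_of_injective hc).trans ?_
  simp only [Cardinal.mk_sum, Cardinal.lift_uzero, Cardinal.lift_id, Cardinal.mk_bool]
  refine Cardinal.add_le_of_le hκ ?_ (Cardinal.add_le_of_le hκ h hI)
  simpa using (Cardinal.natCast_lt_aleph0 (n := 2)).le.trans hκ

end Cardinality

/-! ### Bounding the number of witnessing functions -/

section Substitution

variable {L : FirstOrder.Language.{u, u}} {O N : Type u} [L.Structure N] {k m n : ℕ}

theorem QFDefinable.subst {E : Set ((Fin k → O) → N)} {X : Set (Fin m → O)} (h : QFDefinable L E X)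
    (t : Fin m → Fin n ⊕ O) : QFDefinable L E {a : Fin n → O | (Sum.elim a id ∘ t : Fin m → O) ∈ X} := by
  have key (a : Fin n → O) (s : Fin m ⊕ O) :
      termVal (Sum.elim a id ∘ t) s = termVal a (Sum.elim t Sum.inr s) := by
    rcases s with i | c <;> rfl
  induction h with
  | eq s s' => simpa only [Set.mem_ofPred_eq, key] using QFDefinable.eq (Sum.elim t Sum.inr s) (Sum.elim t Sum.inr s')
  | rel d f hf s Y hY =>
    simpa only [Set.mem_ofPred_eq, key] using QFDefinable.rel d f hf (fun j l => Sum.elim t Sum.inr (s j l)) Y hY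
  | compl X _ h => exact QFDefinable.compl _ h
  | inter X X' _ _ h h' => exact QFDefinable.inter _ _ h h'

variable {L' : FirstOrder.Language.{u, u}}

/-- Parameter-free formulas suffice, since parameters can be substituted afterwards; there are at
most `κ` of them, and each needs finitely many functions. -/
theorem Witnesses.exists_card_le [L'.Structure O] {E : Set ((Fin k → O) → N)} (h : Witnesses L N L' O k E)
    {κ : Cardinal.{u}} (hκ : Cardinal.aleph0 ≤ κ) (hL' : L'.card ≤ κ) :
    ∃ E' : Set ((Fin k → O) → N), Cardinal.mk E' ≤ κ ∧ Witnesses L N L' O k E' := by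
  have hF (φ : Σ m : ℕ, L'.Formula (Fin m)) := (h φ.1 {a | φ.2.Realize a} (definable_formula φ.2)).exists_finite
  choose F _ hF hQ using hF
  refine ⟨⋃ φ, F φ, ?_, fun n X hX => ?_⟩
  · refine (Cardinal.mk_iUnion_le_sum_mk).trans ?_
    have h1 : Cardinal.sum (fun φ => Cardinal.mk (F φ)) ≤
        Cardinal.sum fun _ : (Σ m : ℕ, L'.Formula (Fin m)) => Cardinal.aleph0.{u} :=
      Cardinal.sum_le_sum _ _ fun φ => (hF φ).lt_aleph0.le
    refine h1.trans ?_
    rw [Cardinal.sum_const, Cardinal.lift_id, Cardinal.lift_id]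
    exact Cardinal.mul_le_of_le hκ (mk_sigma_nat_le hκ fun m => mk_formula_le hκ hL' (Fin m)) hκ
  · obtain ⟨m, φ, t, rfl⟩ := exists_eq_realize hX
    exact ((hQ ⟨m, φ⟩).mono (Set.subset_iUnion F _)).subst t

variable {T : L.Theory} {T' : L'.Theory}

theorem LocallyKTraceDefinesWith.locallyKTraceDefines {κ : Cardinal.{u}} (h : LocallyKTraceDefinesWith T T' κ k) :
    LocallyKTraceDefines T T' k := by
  obtain ⟨O, N, E, -, h⟩ := h
  exact ⟨O, N, E, h⟩

theorem LocallyKTraceDefines.with_of_card_le {κ : Cardinal.{u}} (hκ : Cardinal.aleph0 ≤ κ) (hT' : T'.IsMaximal)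
    (hc : Cardinal.mk T' ≤ κ) (h : LocallyKTraceDefines T T' k) : LocallyKTraceDefinesWith T T' κ k := by
  obtain ⟨O, N, E, h⟩ := h
  exact ⟨O, N, h.exists_card_le hκ (card_le_of_isMaximal hκ hT' hc)⟩

end Substitution

/-! ### Sizes of models and theories -/

section Models

variable {L : FirstOrder.Language.{u, u}} {T : L.Theory}

/-- Being infinite and having two elements are invariant under elementary equivalence, so by
completeness the hypothesis on one model holds for all. -/
theorem infinite_or_nontrivial_of_isMaximal (hT : T.IsMaximal) {k : ℕ}
    (h : (∃ M : Theory.ModelType.{u, u, u} T, Infinite M) ∨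
      ((∃ M : Theory.ModelType.{u, u, u} T, Finite M ∧ Nontrivial M) ∧ 2 ≤ k))
    (M : Theory.ModelType.{u, u, u} T) : Infinite M ∨ (2 ≤ k ∧ Nontrivial M) := by
  rcases h with ⟨N, hN⟩ | ⟨⟨N, -, hN⟩, hk⟩
  · exact Or.inl ((Theory.IsComplete.models_elementarily_equivalent hT.isComplete N M).infinite_iff.1 hN)
  · have h1 := elementarilyEquivalent_iff.1
      (Theory.IsComplete.models_elementarily_equivalent hT.isComplete N M) (Sentence.cardGe L 2)
    rw [Sentence.realize_cardGe, Sentence.realize_cardGe] at h1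
    refine Or.inr ⟨hk, ?_⟩
    have h2 := h1.1 (by exact_mod_cast Cardinal.two_le_iff.2 (exists_pair_ne N))
    obtain ⟨x, y, hxy⟩ := Cardinal.two_le_iff.1 (by exact_mod_cast h2)
    exact ⟨x, y, hxy⟩

variable {L' : FirstOrder.Language.{u, u}} {T' : L'.Theory}

theorem mk_theory_le {κ : Cardinal.{u}} (hκ : Cardinal.aleph0 ≤ κ) (hL : L.card ≤ κ) :
    Cardinal.mk T ≤ κ :=
  (Cardinal.mk_set_le T).trans (mk_formula_le hκ hL Empty)

end Models

end TraceDef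

/-! ### The main theorem -/

theorem mainTheorem1 {L : FirstOrder.Language.{u, u}} (T : L.Theory) (hT : T.IsMaximal)
    (k : ℕ) (hk : 1 ≤ k)
    (hTk : (∃ M : FirstOrder.Language.Theory.ModelType.{u, u, u} T, Infinite M) ∨
      ((∃ M : FirstOrder.Language.Theory.ModelType.{u, u, u} T, Finite M ∧ Nontrivial M) ∧ 2 ≤ k))
    (κ : Cardinal.{u}) (hκ : Cardinal.aleph0 ≤ κ) :
    -- both objects are complete consistent deductively closed theories
    (TraceDef.D T k).IsMaximal ∧ (TraceDef.Dκ T κ k).IsMaximal ∧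
    -- (1)
    (∀ (L' : FirstOrder.Language.{u, u}) (T' : L'.Theory), T'.IsMaximal →
      (TraceDef.KTraceDefines T T' k ↔ TraceDef.TraceDefines (TraceDef.D T k) T')) ∧
    -- (2)
    (∀ (L' : FirstOrder.Language.{u, u}) (T' : L'.Theory), T'.IsMaximal →
      (TraceDef.LocallyKTraceDefines T T' k ↔
        TraceDef.LocallyTraceDefines (TraceDef.D T k) T')) ∧
    -- (3)
    (∀ (L' : FirstOrder.Language.{u, u}) (T' : L'.Theory), T'.IsMaximal →
      (TraceDef.LocallyKTraceDefinesWith T T' κ k ↔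
        TraceDef.TraceDefines (TraceDef.Dκ T κ k) T')) ∧
    -- (4)
    (∀ (L' : FirstOrder.Language.{u, u}) (T' : L'.Theory), T'.IsMaximal → Cardinal.mk T' ≤ κ →
      (TraceDef.LocallyKTraceDefines T T' k ↔
        TraceDef.TraceDefines (TraceDef.Dκ T κ k) T')) ∧
    -- (a) the theories satisfying (1) are exactly those trace equivalent to `D_k(T)`
    (∀ (L₀ : FirstOrder.Language.{u, u}) (S : L₀.Theory), S.IsMaximal →
      ((∀ (L' : FirstOrder.Language.{u, u}) (T' : L'.Theory), T'.IsMaximal →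
          (TraceDef.KTraceDefines T T' k ↔ TraceDef.TraceDefines S T')) ↔
        TraceDef.TraceEquivalent S (TraceDef.D T k))) ∧
    -- (b) the theories satisfying (2) are exactly those locally trace equivalent to `D_k(T)`
    (∀ (L₀ : FirstOrder.Language.{u, u}) (S : L₀.Theory), S.IsMaximal →
      ((∀ (L' : FirstOrder.Language.{u, u}) (T' : L'.Theory), T'.IsMaximal →
          (TraceDef.LocallyKTraceDefines T T' k ↔ TraceDef.LocallyTraceDefines S T')) ↔
        TraceDef.LocallyTraceEquivalent S (TraceDef.D T k))) ∧
    -- (c) the theories satisfying (3) are exactly those trace equivalent to `D^κ_k(T)`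
    (∀ (L₀ : FirstOrder.Language.{u, u}) (S : L₀.Theory), S.IsMaximal →
      ((∀ (L' : FirstOrder.Language.{u, u}) (T' : L'.Theory), T'.IsMaximal →
          (TraceDef.LocallyKTraceDefinesWith T T' κ k ↔ TraceDef.TraceDefines S T')) ↔
        TraceDef.TraceEquivalent S (TraceDef.Dκ T κ k))) ∧
    -- (d) if `|T| ≤ κ` then `|D^κ_k(T)| ≤ κ`, and the theories of cardinality `≤ κ` satisfying (4)
    -- for all theories of cardinality `≤ κ` are exactly those trace equivalent to `D^κ_k(T)`
    (Cardinal.mk T ≤ κ →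
      Cardinal.mk (TraceDef.Dκ T κ k) ≤ κ ∧
      ∀ (L₀ : FirstOrder.Language.{u, u}) (S : L₀.Theory), S.IsMaximal → Cardinal.mk S ≤ κ →
        ((∀ (L' : FirstOrder.Language.{u, u}) (T' : L'.Theory), T'.IsMaximal → Cardinal.mk T' ≤ κ →
            (TraceDef.LocallyKTraceDefines T T' k ↔ TraceDef.TraceDefines S T')) ↔
          TraceDef.TraceEquivalent S (TraceDef.Dκ T κ k))) := by
  have hM := TraceDef.infinite_or_nontrivial_of_isMaximal hT hTk
  have hTs := hT.1
  have hD : (TraceDef.D T k).IsMaximal := TraceDef.genTheory_isMaximal hT hk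
  have hDκ : (TraceDef.Dκ T κ k).IsMaximal := TraceDef.genTheory_isMaximal hT hk
  have h1 (L' : FirstOrder.Language.{u, u}) (T' : L'.Theory) (hT' : T'.IsMaximal) :
      TraceDef.KTraceDefines T T' k ↔ TraceDef.TraceDefines (TraceDef.D T k) T' :=
    ⟨fun h => h.traceDefines hk, fun h => h.kTraceDefines hk hM hTs hT'⟩
  have h2 (L' : FirstOrder.Language.{u, u}) (T' : L'.Theory) :
      TraceDef.LocallyKTraceDefines T T' k ↔ TraceDef.LocallyTraceDefines (TraceDef.D T k) T' :=
    ⟨fun h => h.locallyTraceDefines hk, fun h => h.locallyKTraceDefines hk hM⟩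
  have h3 (L' : FirstOrder.Language.{u, u}) (T' : L'.Theory) (hT' : T'.IsMaximal) :
      TraceDef.LocallyKTraceDefinesWith T T' κ k ↔ TraceDef.TraceDefines (TraceDef.Dκ T κ k) T' :=
    ⟨fun h => h.traceDefines, fun h => h.locallyKTraceDefinesWith hκ hk hM hTs hT'⟩
  have h4 (L' : FirstOrder.Language.{u, u}) (T' : L'.Theory) (hT' : T'.IsMaximal) (hc : Cardinal.mk T' ≤ κ) :
      TraceDef.LocallyKTraceDefines T T' k ↔ TraceDef.TraceDefines (TraceDef.Dκ T κ k) T' :=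
    Iff.trans ⟨fun h => h.with_of_card_le hκ hT' hc, fun h => h.locallyKTraceDefines⟩ (h3 L' T' hT')
  refine ⟨hD, hDκ, h1, fun L' T' _ => h2 L' T', h3, h4, fun L₀ S hS => ⟨fun h => ?_, fun h L' T' hT' => ?_⟩,
    fun L₀ S hS => ⟨fun h => ?_, fun h L' T' hT' => ?_⟩, fun L₀ S hS => ⟨fun h => ?_, fun h L' T' hT' => ?_⟩,
    fun hTκ => ?_⟩
  -- Testing both characterisations at the generic theory and at `S` itself gives the two directions
  -- of equivalence; the converse is transitivity. The same pattern proves (b), (c) and (d).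
  · exact ⟨(h _ _ hD).1 ((h1 _ _ hD).2 (.refl hD)), (h1 _ _ hS).1 ((h _ _ hS).2 (.refl hS))⟩
  · exact (h1 _ _ hT').trans ⟨h.1.trans hD, h.2.trans hS⟩
  · exact ⟨(h _ _ hD).1 ((h2 _ _).2 (.refl hD)), (h2 _ _).1 ((h _ _ hS).2 (.refl hS))⟩
  · exact (h2 _ _).trans ⟨h.1.trans hD, h.2.trans hS⟩
  · exact ⟨(h _ _ hDκ).1 ((h3 _ _ hDκ).2 (.refl hDκ)), (h3 _ _ hS).1 ((h _ _ hS).2 (.refl hS))⟩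
  · exact (h3 _ _ hT').trans ⟨h.1.trans hDκ, h.2.trans hS⟩
  -- The bound makes the generic theory an admissible test theory among those of cardinality at most
  -- `κ`.
  · have hc : Cardinal.mk (TraceDef.Dκ T κ k) ≤ κ := TraceDef.mk_theory_le hκ
      (TraceDef.card_genLang_le hκ (TraceDef.card_le_of_isMaximal hκ hT hTκ) (Cardinal.mk_out κ).le k)
    refine ⟨hc, fun L₀ S hS hSκ => ⟨fun h => ?_, fun h L' T' hT' hT'κ => ?_⟩⟩
    · exact ⟨(h _ _ hDκ hc).1 ((h4 _ _ hDκ hc).2 (.refl hDκ)),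
        (h4 _ _ hS hSκ).1 ((h _ _ hS hSκ).2 (.refl hS))⟩
    · exact (h4 _ _ hT' hT'κ).trans ⟨h.1.trans hDκ, h.2.trans hS⟩
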